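/- Let $X$ and $S$ be real analytic manifolds (finite-dimensional, Hausdorff, with countable topology). Let $\mathrm{op}(X_{sa})$ be the family of open subanalytic subsets of $X$; a family $\{U_i\}$ of elements of $\mathrm{op}(X_{sa})$ contained in $U\in \mathrm{op}(X_{sa})$ is a covering of $U$ in $X_{sa}$ if for every compact $K\subset X$ there are finitely many indices $i_1,\dots,i_r$ with $K\cap\bigcup_k U_{i_k}=K\cap U$. Let $X_{sa}\times S$ be the site whose objects are the finite unions of products $U\times V$ with $U\in\mathrm{op}(X_{sa})$ and $V\subset S$ open, ordered by inclusion, with the Grothendieck topology generated by the following coverings: a family $T$ of objects contained in $W$ covers $W$ if for every such product $U\times V\subset W$ the family $\{W'\cap(U\times V)\}_{W'\in T}$ admits a refinement $\{U_i\times V_j\}_{i,j}$ with $\{U_i\}$ a covering of $U$ in $X_{sa}$ and $\{V_j\}$ an open covering of $V$. Let $\mathcal T$ be the family of products $U\times V$ with $U\subset X$ and $V\subset S$ open, subanalytic and relatively compact. Let $X_{sa}\times S_{sa}$ be the site whose objects are the locally finite unions of elements of $\mathcal T$, in which $T$ covers $W$ if for every $R\in\mathcal T$ with $R\subset W$ the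 family $\{W'\cap R\}_{W'\in T}$ admits a finite subcover of $R$. For each of the sites $\mathcal S = X\times S$ (usual topology), $X_{sa}\times S$ and $X_{sa}\times S_{sa}$, let $\mathrm{Mod}(\mathbb C_{\mathcal S})$ be the category of sheaves of $\mathbb C$-vector spaces on $\mathcal S$. Let $\rho_S: X\times S\to X_{sa}\times S$ and $\rho':X\times S\to X_{sa}\times S_{sa}$ be the morphisms of sites given by the inclusions of the families of open sets, with inverse image functors $\rho_S^{-1}$ and $\rho'^{-1}$, and let $a: X_{sa}\times S\to X_{sa}\times S_{sa}$ be the morphism of sites given on the basis $\mathcal T$ of $X_{sa}\times S_{sa}$ by inclusion: $a^{-1}G$ is the inverse image of $G|_{\mathcal T}$ along the inclusion of $\mathcal T$ in the objects of $X_{sa}\times S$, where $\mathcal T$ carries the topology in which coverings are the families admitting a finite subcover. Then $\rho'^{-1}$ has a left adjoint $\rho'_!$, and the functor $$\rho_{S!}:=a^{-1}\circ\rho'_!:\ \mathrm{Mod}(\mathbb C_{X\times S})\to\mathrm{Mod}(\mathbb C_{X_{sa}\times S})$$ is left adjoint to $\rho_S^{-1}$. The functor $\rho_{S!}$ is exact,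 and it commutes with tensor products: there is an isomorphism $\rho_{S!}(A\otimes B)\simeq\rho_{S!}A\otimes\rho_{S!}B$, natural in $A,B\in\mathrm{Mod}(\mathbb C_{X\times S})$, for which the composite $$A\otimes B\to\rho_S^{-1}\rho_{S!}(A\otimes B)\simeq\rho_S^{-1}(\rho_{S!}A\otimes\rho_{S!}B)\to\rho_S^{-1}\rho_{S!}A\otimes\rho_S^{-1}\rho_{S!}B$$ of the adjunction unit, the image of the isomorphism and the canonical morphism is the tensor product of the adjunction units of $A$ and $B$. -/

import Mathlib

open CategoryTheory TopologicalSpace MonoidalCategory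
open scoped Manifold ContDiff

attribute [local instance] CategoryTheory.Sheaf.monoidalCategory

noncomputable section

namespace RelSubanalytic

/-! ### Semianalytic and subanalytic sets -/

section Subanalytic

variable {E H : Type*} [NormedAddCommGroup E] [NormedSpace ℝ E] [TopologicalSpace H]
  (I : ModelWithCorners ℝ E H) {M : Type*} [TopologicalSpace M] [ChartedSpace H M]

/-- `A ⊆ M` is semianalytic: every point of `M` has an open neighbourhood `U` on which `A` is a
finite union of sets, each of them given by finitely many equations `f = 0` and strict
inequalities `g > 0` between real analytic functions on `U`. -/
def IsSemianalytic (A : Set M) : Prop :=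
  ∀ x : M, ∃ U : Set M, IsOpen U ∧ x ∈ U ∧
    ∃ (ι κ : Type) (_ : Finite ι) (_ : Finite κ) (f g : ι → κ → M → ℝ),
      (∀ i j, ContMDiffOn I 𝓘(ℝ, ℝ) ω (f i j) U ∧ ContMDiffOn I 𝓘(ℝ, ℝ) ω (g i j) U) ∧
      A ∩ U = {y | y ∈ U ∧ ∃ i, ∀ j, f i j y = 0 ∧ 0 < g i j y}

/-- `A ⊆ M` is subanalytic: every point of `M` has an open neighbourhood `U` such that `A ∩ U` is
the projection to `M` of a relatively compact semianalytic subset of `M × V`, for some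
finite-dimensional real vector space `V`. -/
def IsSubanalytic (A : Set M) : Prop :=
  ∀ x : M, ∃ U : Set M, IsOpen U ∧ x ∈ U ∧
    ∃ (V : Type) (_ : NormedAddCommGroup V) (_ : NormedSpace ℝ V) (_ : FiniteDimensional ℝ V)
      (B : Set (M × V)),
      IsSemianalytic (I.prod 𝓘(ℝ, V)) B ∧ IsCompact (closure B) ∧ A ∩ U = Prod.fst '' B

variable {I}

theorem IsSemianalytic.inter {A B : Set M} (hA : IsSemianalytic I A) (hB : IsSemianalytic I B) :
    IsSemianalytic I (A ∩ B) := by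
  intro x
  obtain ⟨U, hU, hxU, ι, κ, _, _, f, g, hfg, hAU⟩ := hA x
  obtain ⟨U', hU', hxU', ι', κ', _, _, f', g', hfg', hBU⟩ := hB x
  refine ⟨U ∩ U', hU.inter hU', ⟨hxU, hxU'⟩, ι × ι', κ ⊕ κ', inferInstance, inferInstance,
    fun i => Sum.elim (f i.1) (f' i.2), fun i => Sum.elim (g i.1) (g' i.2), ?_, ?_⟩
  · rintro ⟨i, i'⟩ (j | j)
    · exact ⟨(hfg i j).1.mono Set.inter_subset_left, (hfg i j).2.mono Set.inter_subset_left⟩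
    · exact ⟨(hfg' i' j).1.mono Set.inter_subset_right, (hfg' i' j).2.mono Set.inter_subset_right⟩
  · ext y
    have h1 := Set.ext_iff.1 hAU y
    have h2 := Set.ext_iff.1 hBU y
    simp only [Set.mem_inter_iff, Set.mem_ofPred_eq] at h1 h2
    simp only [Set.mem_inter_iff, Set.mem_ofPred_eq, Prod.exists, Sum.forall, Sum.elim_inl,
      Sum.elim_inr]
    constructor
    · rintro ⟨⟨hyA, hyB⟩, hy, hy'⟩
      obtain ⟨-, i, hi⟩ := h1.1 ⟨hyA, hy⟩
      obtain ⟨-, i', hi'⟩ := h2.1 ⟨hyB, hy'⟩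
      exact ⟨⟨hy, hy'⟩, i, i', hi, hi'⟩
    · rintro ⟨⟨hy, hy'⟩, i, i', hi, hi'⟩
      exact ⟨⟨(h1.2 ⟨hy, i, hi⟩).1, (h2.2 ⟨hy', i', hi'⟩).1⟩, hy, hy'⟩

theorem IsSemianalytic.preimage {E' H' M' : Type*} [NormedAddCommGroup E'] [NormedSpace ℝ E']
    [TopologicalSpace H'] {I' : ModelWithCorners ℝ E' H'} [TopologicalSpace M']
    [ChartedSpace H' M'] {φ : M' → M} (hφ : ContMDiff I' I ω φ) {A : Set M}
    (hA : IsSemianalytic I A) : IsSemianalytic I' (φ ⁻¹' A) := by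
  intro x
  obtain ⟨U, hU, hxU, ι, κ, _, _, f, g, hfg, hAU⟩ := hA (φ x)
  refine ⟨φ ⁻¹' U, hU.preimage hφ.continuous, hxU, ι, κ, inferInstance, inferInstance,
    fun i j => f i j ∘ φ, fun i j => g i j ∘ φ, fun i j => ⟨?_, ?_⟩, ?_⟩
  · exact (hfg i j).1.comp hφ.contMDiffOn subset_rfl
  · exact (hfg i j).2.comp hφ.contMDiffOn subset_rfl
  · rw [← Set.preimage_inter, hAU]
    rfl

/-- The intersection of two subanalytic sets is subanalytic (by fibre products over `M`). -/
theorem IsSubanalytic.inter [T2Space M] {A A' : Set M} (hA : IsSubanalytic I A)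
    (hA' : IsSubanalytic I A') : IsSubanalytic I (A ∩ A') := by
  intro x
  obtain ⟨U, hU, hxU, V, _, _, _, B, hB, hBc, hAU⟩ := hA x
  obtain ⟨U', hU', hxU', V', _, _, _, B', hB', hBc', hAU'⟩ := hA' x
  let p : M × (V × V') → M × V := fun z => (z.1, z.2.1)
  let p' : M × (V × V') → M × V' := fun z => (z.1, z.2.2)
  have hp : ContMDiff (I.prod 𝓘(ℝ, V × V')) (I.prod 𝓘(ℝ, V)) ω p :=
    contMDiff_fst.prodMk ((ContinuousLinearMap.fst ℝ V V').contMDiff.comp contMDiff_snd)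
  have hp' : ContMDiff (I.prod 𝓘(ℝ, V × V')) (I.prod 𝓘(ℝ, V')) ω p' :=
    contMDiff_fst.prodMk ((ContinuousLinearMap.snd ℝ V V').contMDiff.comp contMDiff_snd)
  refine ⟨U ∩ U', hU.inter hU', ⟨hxU, hxU'⟩, V × V', inferInstance, inferInstance, inferInstance,
    p ⁻¹' B ∩ p' ⁻¹' B', (hB.preimage hp).inter (hB'.preimage hp'), ?_, ?_⟩
  · have hK : IsCompact ((Prod.fst '' closure B) ×ˢ
        ((Prod.snd '' closure B) ×ˢ (Prod.snd '' closure B'))) :=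
      (hBc.image continuous_fst).prod ((hBc.image continuous_snd).prod (hBc'.image continuous_snd))
    refine hK.closure_of_subset ?_
    rintro ⟨m, v, v'⟩ ⟨h1, h2⟩
    exact ⟨⟨(m, v), subset_closure h1, rfl⟩, ⟨(m, v), subset_closure h1, rfl⟩,
      ⟨(m, v'), subset_closure h2, rfl⟩⟩
  · ext y
    have h1 := Set.ext_iff.1 hAU y
    have h2 := Set.ext_iff.1 hAU' y
    simp only [Set.mem_inter_iff, Set.mem_image, Prod.exists, exists_and_right,
      exists_eq_right] at h1 h2
    simp only [Set.mem_inter_iff, Set.mem_image, Prod.exists, Set.mem_preimage, p, p']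
    constructor
    · rintro ⟨⟨hyA, hyA'⟩, hy, hy'⟩
      obtain ⟨v, hv⟩ := h1.1 ⟨hyA, hy⟩
      obtain ⟨v', hv'⟩ := h2.1 ⟨hyA', hy'⟩
      exact ⟨y, v, v', ⟨hv, hv'⟩, rfl⟩
    · rintro ⟨_, v, v', ⟨hv, hv'⟩, rfl⟩
      exact ⟨⟨(h1.2 ⟨v, hv⟩).1, (h2.2 ⟨v', hv'⟩).1⟩, (h1.2 ⟨v, hv⟩).2, (h2.2 ⟨v', hv'⟩).2⟩

end Subanalytic

/-! ### The families of open subsets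

`X` and `S` are real analytic manifolds modelled on `E` and `F`. -/

section Opens

/-- `U` is an object of `op(X_sa)`: an open subanalytic subset of the manifold `X`. -/
def IsSaOpen (E : Type) [NormedAddCommGroup E] [NormedSpace ℝ E] {X : Type} [TopologicalSpace X]
    [ChartedSpace E X] (U : Set X) : Prop :=
  IsOpen U ∧ IsSubanalytic 𝓘(ℝ, E) U

/-- `𝒰` is a covering of `U` in the subanalytic site `X_sa`. -/
def IsSaCover (E : Type) [NormedAddCommGroup E] [NormedSpace ℝ E] {X : Type} [TopologicalSpace X]
    [ChartedSpace E X] (U : Set X) (𝒰 : Set (Set X)) : Prop :=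
  (∀ U' ∈ 𝒰, IsSaOpen E U' ∧ U' ⊆ U) ∧
    ∀ K : Set X, IsCompact K → ∃ 𝒰₀ ⊆ 𝒰, 𝒰₀.Finite ∧ K ∩ ⋃₀ 𝒰₀ = K ∩ U

/-- `𝒱` is an open covering of `V` in the usual topology of `S`. -/
def IsOpenCover {S : Type} [TopologicalSpace S] (V : Set S) (𝒱 : Set (Set S)) : Prop :=
  (∀ V' ∈ 𝒱, IsOpen V') ∧ ⋃₀ 𝒱 = V

theorem IsSaOpen.inter {E : Type} [NormedAddCommGroup E] [NormedSpace ℝ E] {X : Type}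
    [TopologicalSpace X] [ChartedSpace E X] [T2Space X] {U U' : Set X} (h : IsSaOpen E U)
    (h' : IsSaOpen E U') : IsSaOpen E (U ∩ U') :=
  ⟨h.1.inter h'.1, h.2.inter h'.2⟩

variable (E F : Type) [NormedAddCommGroup E] [NormedSpace ℝ E] [NormedAddCommGroup F]
  [NormedSpace ℝ F] {X S : Type} [TopologicalSpace X] [ChartedSpace E X]
  [TopologicalSpace S] [ChartedSpace F S]

/-- `R` belongs to the family `𝒯` of products `U × V` with `U` and `V` relatively compact
subanalytic open subsets of `X` and of `S`. -/
def IsBox (R : Set (X × S)) : Prop :=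
  ∃ (U : Set X) (V : Set S), (IsSaOpen E U ∧ IsCompact (closure U)) ∧
    (IsSaOpen F V ∧ IsCompact (closure V)) ∧ R = U ×ˢ V

/-- `W` is an object of `op(X_sa × S_sa)`: a locally finite union of elements of `𝒯`. -/
def IsBiSaOpen (W : Set (X × S)) : Prop :=
  ∃ 𝓑 : Set (Set (X × S)), (∀ R ∈ 𝓑, IsBox E F R) ∧ LocallyFinite (fun R : 𝓑 => (R : Set (X × S))) ∧
    W = ⋃₀ 𝓑

/-- `W` is an object of `op(X_sa × S)`: a finite union of products `U × V` with `U` open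
subanalytic in `X` and `V` open in `S`. -/
def IsRelOpen (W : Set (X × S)) : Prop :=
  ∃ 𝓟 : Set (Set (X × S)), 𝓟.Finite ∧
    (∀ P ∈ 𝓟, ∃ (U : Set X) (V : Set S), IsSaOpen E U ∧ IsOpen V ∧ P = U ×ˢ V) ∧ W = ⋃₀ 𝓟

variable {E F}

theorem IsBox.inter [T2Space X] [T2Space S] {R R' : Set (X × S)} (h : IsBox E F R)
    (h' : IsBox E F R') : IsBox E F (R ∩ R') := by
  obtain ⟨U, V, ⟨hU, hUc⟩, ⟨hV, hVc⟩, rfl⟩ := h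
  obtain ⟨U', V', ⟨hU', -⟩, ⟨hV', -⟩, rfl⟩ := h'
  exact ⟨U ∩ U', V ∩ V',
    ⟨hU.inter hU', hUc.of_isClosed_subset isClosed_closure (closure_mono Set.inter_subset_left)⟩,
    ⟨hV.inter hV', hVc.of_isClosed_subset isClosed_closure (closure_mono Set.inter_subset_left)⟩,
    Set.prod_inter_prod⟩

theorem IsBox.isOpen {R : Set (X × S)} (h : IsBox E F R) : IsOpen R := by
  obtain ⟨U, V, ⟨hU, -⟩, ⟨hV, -⟩, rfl⟩ := h
  exact hU.1.prod hV.1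

theorem IsBox.isCompact_closure {R : Set (X × S)} (h : IsBox E F R) : IsCompact (closure R) := by
  obtain ⟨U, V, ⟨-, hU⟩, ⟨-, hV⟩, rfl⟩ := h
  rw [closure_prod_eq]
  exact hU.prod hV

theorem IsBox.isBiSaOpen {R : Set (X × S)} (h : IsBox E F R) : IsBiSaOpen E F R :=
  ⟨{R}, by simpa using h, locallyFinite_of_finite _, by simp⟩

theorem IsBox.isRelOpen {R : Set (X × S)} (h : IsBox E F R) : IsRelOpen E R := by
  obtain ⟨U, V, ⟨hU, -⟩, ⟨hV, -⟩, rfl⟩ := h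
  exact ⟨{U ×ˢ V}, Set.finite_singleton _, by rintro _ rfl; exact ⟨U, V, hU, hV.1, rfl⟩, by simp⟩

theorem IsBiSaOpen.inter [T2Space X] [T2Space S] {W W' : Set (X × S)} (h : IsBiSaOpen E F W)
    (h' : IsBiSaOpen E F W') : IsBiSaOpen E F (W ∩ W') := by
  obtain ⟨𝓑, h𝓑, hf, rfl⟩ := h
  obtain ⟨𝓑', h𝓑', hf', rfl⟩ := h'
  refine ⟨Set.image2 (· ∩ ·) 𝓑 𝓑', ?_, ?_, ?_⟩
  · rintro _ ⟨R, hR, R', hR', rfl⟩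
    exact (h𝓑 R hR).inter (h𝓑' R' hR')
  · intro z
    obtain ⟨t, ht, hfin⟩ := hf z
    obtain ⟨t', ht', hfin'⟩ := hf' z
    refine ⟨t ∩ t', Filter.inter_mem ht ht', ?_⟩
    refine Set.Finite.of_finite_image (f := Subtype.val) ?_ Subtype.val_injective.injOn
    refine ((hfin.image Subtype.val).image2 (· ∩ ·) (hfin'.image Subtype.val)).subset ?_
    rintro _ ⟨⟨_, R, hR, R', hR', rfl⟩, ⟨y, ⟨hyR, hyR'⟩, hyt, hyt'⟩, rfl⟩
    exact ⟨R, ⟨⟨R, hR⟩, ⟨y, hyR, hyt⟩, rfl⟩, R', ⟨⟨R', hR'⟩, ⟨y, hyR', hyt'⟩, rfl⟩, rfl⟩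
  · rw [Set.sUnion_inter_sUnion]
    ext y
    simp only [Set.mem_iUnion, Set.mem_sUnion, Set.mem_image2]
    aesop

theorem IsRelOpen.inter [T2Space X] {W W' : Set (X × S)} (h : IsRelOpen E W)
    (h' : IsRelOpen E W') : IsRelOpen E (W ∩ W') := by
  obtain ⟨𝓟, hf, h𝓟, rfl⟩ := h
  obtain ⟨𝓟', hf', h𝓟', rfl⟩ := h'
  refine ⟨Set.image2 (· ∩ ·) 𝓟 𝓟', hf.image2 _ hf', ?_, ?_⟩
  · rintro _ ⟨P, hP, P', hP', rfl⟩
    obtain ⟨U, V, hU, hV, rfl⟩ := h𝓟 P hP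
    obtain ⟨U', V', hU', hV', rfl⟩ := h𝓟' P' hP'
    exact ⟨U ∩ U', V ∩ V', hU.inter hU', hV.inter hV', Set.prod_inter_prod⟩
  · rw [Set.sUnion_inter_sUnion]
    ext y
    simp only [Set.mem_iUnion, Set.mem_sUnion, Set.mem_image2]
    aesop

/-- An element of `op(X_sa × S_sa)` is, inside an element of `𝒯`, a finite union of elements
of `𝒯`. -/
theorem IsBiSaOpen.finite_boxes [T2Space X] [T2Space S] {W R : Set (X × S)}
    (hW : IsBiSaOpen E F W) (hR : IsBox E F R) :
    ∃ 𝓑 : Set (Set (X × S)), 𝓑.Finite ∧ (∀ R' ∈ 𝓑, IsBox E F R' ∧ R' ⊆ W ∧ R' ⊆ R) ∧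
      W ∩ R ⊆ ⋃₀ 𝓑 := by
  obtain ⟨𝓑, h𝓑, hf, rfl⟩ := hW
  refine ⟨(fun R' : 𝓑 => (R' : Set (X × S)) ∩ R) ''
    {R' : 𝓑 | ((R' : Set (X × S)) ∩ closure R).Nonempty},
    (hf.finite_nonempty_inter_compact hR.isCompact_closure).image _, ?_, ?_⟩
  · rintro _ ⟨R', -, rfl⟩
    exact ⟨(h𝓑 _ R'.2).inter hR,
      Set.inter_subset_left.trans (Set.subset_sUnion_of_mem R'.2), Set.inter_subset_right⟩
  · rintro y ⟨⟨R', hR', hy⟩, hyR⟩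
    exact ⟨R' ∩ R, ⟨⟨R', hR'⟩, ⟨y, hy, subset_closure hyR⟩, rfl⟩, hy, hyR⟩

end Opens

/-! ### The sites -/

section Sites

variable (E F X S : Type) [NormedAddCommGroup E] [NormedSpace ℝ E] [NormedAddCommGroup F]
  [NormedSpace ℝ F] [TopologicalSpace X] [ChartedSpace E X] [TopologicalSpace S] [ChartedSpace F S]

/-- The family `𝒯`, ordered by inclusion and regarded as a category. -/
abbrev Box : Type := {W : Opens (X × S) // IsBox E F (W : Set (X × S))}

/-- The category `op(X_sa × S_sa)`. -/
abbrev BiSaOpen : Type := {W : Opens (X × S) // IsBiSaOpen E F (W : Set (X × S))}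

/-- The category `op(X_sa × S)`. -/
abbrev RelOpen : Type := {W : Opens (X × S) // IsRelOpen E (W : Set (X × S))}

variable [T2Space X] [T2Space S]

/-- The topology of `X_sa × S_sa` restricted to `𝒯`: the coverings of `R ∈ 𝒯` are those which
admit a finite subcover. -/
def boxTopology : GrothendieckTopology (Box E F X S) where
  sieves R := {T | ∃ Φ : Set (Box E F X S), Φ.Finite ∧ (∀ R' ∈ Φ, ∃ f : R' ⟶ R, T f) ∧
    (R.1 : Set (X × S)) ⊆ ⋃ R' ∈ Φ, (R'.1 : Set (X × S))}
  top_mem' R := ⟨{R}, Set.finite_singleton R, by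
    rintro _ rfl
    exact ⟨𝟙 _, trivial⟩, by simp⟩
  pullback_stable' := by
    rintro R R' T f ⟨Φ, hΦ, hT, hR⟩
    refine ⟨(fun Q : Box E F X S => ⟨Q.1 ⊓ R'.1, Q.2.inter R'.2⟩) '' Φ, hΦ.image _, ?_, ?_⟩
    · rintro _ ⟨Q, hQ, rfl⟩
      obtain ⟨g, hg⟩ := hT Q hQ
      exact ⟨homOfLE (inf_le_right : Q.1 ⊓ R'.1 ≤ R'.1),
        T.downward_closed hg (homOfLE (inf_le_left : Q.1 ⊓ R'.1 ≤ Q.1))⟩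
    · intro y hy
      obtain ⟨Q, hQ, hyQ⟩ := Set.mem_iUnion₂.1 (hR (leOfHom f hy))
      exact Set.mem_iUnion₂.2 ⟨_, ⟨Q, hQ, rfl⟩, hyQ, hy⟩
  transitive' := by
    rintro R T ⟨Φ, hΦ, hT, hR⟩ T' h
    have h' : ∀ Q : Φ, ∃ Ψ : Set (Box E F X S), Ψ.Finite ∧ (∀ R' ∈ Ψ, ∃ f : R' ⟶ R, T' f) ∧
        (Q.1.1 : Set (X × S)) ⊆ ⋃ R' ∈ Ψ, (R'.1 : Set (X × S)) := by
      rintro ⟨Q, hQ⟩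
      obtain ⟨g, hg⟩ := hT Q hQ
      obtain ⟨Ψ, hΨ, h1, h2⟩ := h hg
      exact ⟨Ψ, hΨ, fun R' hR' => (h1 R' hR').elim fun f hf => ⟨f ≫ g, hf⟩, h2⟩
    choose Ψ hΨ h1 h2 using h'
    have := hΦ.to_subtype
    refine ⟨⋃ Q, Ψ Q, Set.finite_iUnion hΨ, ?_, ?_⟩
    · intro R' hR'
      obtain ⟨Q, hQ⟩ := Set.mem_iUnion.1 hR'
      exact h1 Q R' hQ
    · intro y hy
      obtain ⟨Q, hQ, hyQ⟩ := Set.mem_iUnion₂.1 (hR hy)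
      obtain ⟨R', hR', hyR'⟩ := Set.mem_iUnion₂.1 (h2 ⟨Q, hQ⟩ hyQ)
      exact Set.mem_iUnion₂.2 ⟨R', Set.mem_iUnion.2 ⟨_, hR'⟩, hyR'⟩

/-- The topology of the site `X_sa × S_sa`: `T` is a covering of `W` if for every `R ∈ 𝒯` with
`R ⊆ W` the family of the `W' ∩ R`, `W' ∈ T`, admits a finite subcover of `R`. -/
def biSaTopology : GrothendieckTopology (BiSaOpen E F X S) where
  sieves W := {T | ∀ R : Box E F X S, R.1 ≤ W.1 →
    ∃ Φ : Set (BiSaOpen E F X S), Φ.Finite ∧ (∀ W' ∈ Φ, ∃ f : W' ⟶ W, T f) ∧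
      (R.1 : Set (X × S)) ⊆ ⋃ W' ∈ Φ, (W'.1 : Set (X × S))}
  top_mem' W := fun R hR => ⟨{W}, Set.finite_singleton W, by
    rintro _ rfl
    exact ⟨𝟙 _, trivial⟩, by simpa using hR⟩
  pullback_stable' := by
    intro W W' T f h R hRW'
    obtain ⟨Φ, hΦ, hT, hR⟩ := h R (hRW'.trans (leOfHom f))
    refine ⟨(fun Q : BiSaOpen E F X S => ⟨Q.1 ⊓ W'.1, Q.2.inter W'.2⟩) '' Φ, hΦ.image _, ?_, ?_⟩
    · rintro _ ⟨Q, hQ, rfl⟩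
      obtain ⟨g, hg⟩ := hT Q hQ
      exact ⟨homOfLE (inf_le_right : Q.1 ⊓ W'.1 ≤ W'.1),
        T.downward_closed hg (homOfLE (inf_le_left : Q.1 ⊓ W'.1 ≤ Q.1))⟩
    · intro y hy
      obtain ⟨Q, hQ, hyQ⟩ := Set.mem_iUnion₂.1 (hR hy)
      exact Set.mem_iUnion₂.2 ⟨_, ⟨Q, hQ, rfl⟩, hyQ, hRW' hy⟩
  transitive' := by
    intro W T hT' T' h R hRW
    obtain ⟨Φ, hΦ, hT, hR⟩ := hT' R hRW
    have h' : ∀ Q : Φ, ∃ Ψ : Set (BiSaOpen E F X S), Ψ.Finite ∧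
        (∀ W' ∈ Ψ, ∃ f : W' ⟶ W, T' f) ∧
        (Q.1.1 : Set (X × S)) ∩ R.1 ⊆ ⋃ W' ∈ Ψ, (W'.1 : Set (X × S)) := by
      rintro ⟨Q, hQ⟩
      obtain ⟨g, hg⟩ := hT Q hQ
      obtain ⟨𝓑, hfin, hbox, hcov⟩ := Q.2.finite_boxes R.2
      have h'' : ∀ P : 𝓑, ∃ Ψ : Set (BiSaOpen E F X S), Ψ.Finite ∧
          (∀ W' ∈ Ψ, ∃ f : W' ⟶ W, T' f) ∧
          (P : Set (X × S)) ⊆ ⋃ W' ∈ Ψ, (W'.1 : Set (X × S)) := by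
        rintro ⟨P, hP⟩
        obtain ⟨Ψ, hΨ, h1, h2⟩ := h hg ⟨⟨P, (hbox P hP).1.isOpen⟩, (hbox P hP).1⟩ (hbox P hP).2.1
        exact ⟨Ψ, hΨ, fun W' hW' => (h1 W' hW').elim fun f hf => ⟨f ≫ g, hf⟩, h2⟩
      choose Ψ hΨ h1 h2 using h''
      have := hfin.to_subtype
      refine ⟨⋃ P, Ψ P, Set.finite_iUnion hΨ, ?_, ?_⟩
      · intro W' hW'
        obtain ⟨P, hP⟩ := Set.mem_iUnion.1 hW'
        exact h1 P W' hP
      · intro y hy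
        obtain ⟨P, hP, hyP⟩ := hcov hy
        obtain ⟨W', hW', hyW'⟩ := Set.mem_iUnion₂.1 (h2 ⟨P, hP⟩ hyP)
        exact Set.mem_iUnion₂.2 ⟨W', Set.mem_iUnion.2 ⟨_, hW'⟩, hyW'⟩
    choose Ψ hΨ h1 h2 using h'
    have := hΦ.to_subtype
    refine ⟨⋃ Q, Ψ Q, Set.finite_iUnion hΨ, ?_, ?_⟩
    · intro W' hW'
      obtain ⟨Q, hQ⟩ := Set.mem_iUnion.1 hW'
      exact h1 Q W' hQ
    · intro y hy
      obtain ⟨Q, hQ, hyQ⟩ := Set.mem_iUnion₂.1 (hR hy)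
      obtain ⟨W', hW', hyW'⟩ := Set.mem_iUnion₂.1 (h2 ⟨Q, hQ⟩ ⟨hyQ, hy⟩)
      exact Set.mem_iUnion₂.2 ⟨W', Set.mem_iUnion.2 ⟨_, hW'⟩, hyW'⟩

variable {E S} in
/-- The presieve `T` on `W` is a covering of `W` in `X_sa × S`: for every product `U × V ⊆ W` with
`U` in `op(X_sa)` and `V` open in `S`, the restriction of `T` to `U × V` admits a refinement
`{U_i × V_j}` with `{U_i}` a covering of `U` in `X_sa` and `{V_j}` an open covering of `V`. -/
def IsRelCover (W : RelOpen E X S) (T : Presieve W) : Prop :=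
  ∀ (U : Set X) (V : Set S), IsSaOpen E U → IsOpen V → U ×ˢ V ⊆ (W.1 : Set (X × S)) →
    ∃ (𝒰 : Set (Set X)) (𝒱 : Set (Set S)), IsSaCover E U 𝒰 ∧ IsOpenCover V 𝒱 ∧
      ∀ U' ∈ 𝒰, ∀ V' ∈ 𝒱, ∃ (W' : RelOpen E X S) (f : W' ⟶ W),
        T f ∧ U' ×ˢ V' ⊆ (W'.1 : Set (X × S))

/-- The coverings of `X_sa × S`. -/
def relCoverage : Coverage (RelOpen E X S) where
  coverings W := {T | IsRelCover X W T}
  pullback := by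
    intro W W₁ f T hT
    refine ⟨fun Z _ => ∃ (W' : RelOpen E X S) (g : W' ⟶ W), T g ∧ Z ≤ W', ?_, ?_⟩
    · intro U V hU hV hUV
      obtain ⟨𝒰, 𝒱, h𝒰, h𝒱, h⟩ := hT U V hU hV (hUV.trans (leOfHom f))
      refine ⟨𝒰, 𝒱, h𝒰, h𝒱, fun U' hU' V' hV' => ?_⟩
      obtain ⟨W', g, hg, hsub⟩ := h U' hU' V' hV'
      have h1 : IsSaOpen E U' := (h𝒰.1 U' hU').1
      have h2 : IsOpen V' := h𝒱.1 V' hV'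
      have h3 : U' ×ˢ V' ⊆ (W₁.1 : Set (X × S)) :=
        (Set.prod_mono (h𝒰.1 U' hU').2 (h𝒱.2 ▸ Set.subset_sUnion_of_mem hV')).trans hUV
      exact ⟨⟨⟨U' ×ˢ V', h1.1.prod h2⟩,
        ⟨{U' ×ˢ V'}, Set.finite_singleton _, by rintro _ rfl; exact ⟨U', V', h1, h2, rfl⟩, by simp⟩⟩,
        homOfLE h3, ⟨W', g, hg, hsub⟩, subset_rfl⟩
    · rintro Z i ⟨W', g, hg, hle⟩
      exact ⟨W', homOfLE hle, g, hg, Subsingleton.elim _ _⟩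

/-- The topology of the site `X_sa × S`, generated by its coverings. -/
def relTopology : GrothendieckTopology (RelOpen E X S) := (relCoverage E X S).toGrothendieck

/-! ### The functors between the categories of open subsets -/

/-- The inclusion `𝒯 ⊆ op(X_sa × S_sa)`. -/
def boxToBiSa : Box E F X S ⥤ BiSaOpen E F X S :=
  Monotone.functor (f := fun R => ⟨R.1, R.2.isBiSaOpen⟩) fun _ _ h => h

/-- The inclusion `𝒯 ⊆ op(X_sa × S)`. -/
def boxToRel : Box E F X S ⥤ RelOpen E X S :=
  Monotone.functor (f := fun R => ⟨R.1, R.2.isRelOpen⟩) fun _ _ h => h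

/-- The inclusion `op(X_sa × S_sa) ⊆ op(X × S)`. -/
def biSaToOpens : BiSaOpen E F X S ⥤ Opens (X × S) :=
  Monotone.functor (f := fun W => W.1) fun _ _ h => h

/-- The inclusion `op(X_sa × S) ⊆ op(X × S)`. -/
def relToOpens : RelOpen E X S ⥤ Opens (X × S) :=
  Monotone.functor (f := fun W => W.1) fun _ _ h => h

theorem compatiblePreserving_of_inf {C D : Type} [PartialOrder C] [PartialOrder D]
    (K : GrothendieckTopology D) (G : C ⥤ D)
    (h : ∀ a b : C, ∃ c, c ≤ a ∧ c ≤ b ∧ ∀ d, d ≤ G.obj a → d ≤ G.obj b → d ≤ G.obj c) :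
    CompatiblePreserving.{0} K G := by
  constructor
  intro ℱ Z T x hx Y₁ Y₂ X f₁ f₂ g₁ g₂ hg₁ hg₂ _
  obtain ⟨c, h1, h2, h3⟩ := h Y₁ Y₂
  have e1 : f₁ = homOfLE (h3 X (leOfHom f₁) (leOfHom f₂)) ≫ G.map (homOfLE h1) :=
    Subsingleton.elim _ _
  have e2 : f₂ = homOfLE (h3 X (leOfHom f₁) (leOfHom f₂)) ≫ G.map (homOfLE h2) :=
    Subsingleton.elim _ _
  have := hx (homOfLE h1) (homOfLE h2) hg₁ hg₂ (Subsingleton.elim _ _)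
  rw [e1, e2]
  simp only [op_comp, Functor.map_comp, types_comp_apply]
  exact congrArg _ this

instance : (boxToBiSa E F X S).IsContinuous (boxTopology E F X S) (biSaTopology E F X S) := by
  refine Functor.isContinuous_of_coverPreserving (compatiblePreserving_of_inf _ _ ?_) ⟨?_⟩
  · exact fun R R' => ⟨⟨R.1 ⊓ R'.1, R.2.inter R'.2⟩, (inf_le_left : R.1 ⊓ R'.1 ≤ R.1),
      (inf_le_right : R.1 ⊓ R'.1 ≤ R'.1), fun d h h' => (le_inf h h' : d.1 ≤ R.1 ⊓ R'.1)⟩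
  · rintro R T ⟨Φ, hΦ, hT, hR⟩ Q hQ
    refine ⟨(boxToBiSa E F X S).obj '' Φ, hΦ.image _, ?_, ?_⟩
    · rintro _ ⟨R', hR', rfl⟩
      obtain ⟨f, hf⟩ := hT R' hR'
      exact ⟨_, Sieve.image_mem_functorPushforward (boxToBiSa E F X S) T hf⟩
    · intro y hy
      obtain ⟨R', hR', hyR'⟩ := Set.mem_iUnion₂.1 (hR (hQ hy))
      exact Set.mem_iUnion₂.2 ⟨_, ⟨R', hR', rfl⟩, hyR'⟩

instance : (boxToRel E F X S).IsContinuous (boxTopology E F X S) (relTopology E X S) := by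
  refine Functor.isContinuous_of_coverPreserving (compatiblePreserving_of_inf _ _ ?_) ⟨?_⟩
  · exact fun R R' => ⟨⟨R.1 ⊓ R'.1, R.2.inter R'.2⟩, (inf_le_left : R.1 ⊓ R'.1 ≤ R.1),
      (inf_le_right : R.1 ⊓ R'.1 ≤ R'.1), fun d h h' => (le_inf h h' : d.1 ≤ R.1 ⊓ R'.1)⟩
  · rintro R T ⟨Φ, hΦ, hT, hR⟩
    have hgen : IsRelCover X ((boxToRel E F X S).obj R)
        (T.functorPushforward (boxToRel E F X S)).arrows := by
      intro U V hU hV hUV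
      have key : ∀ Q : Box E F X S, ∃ (A : Set X) (B : Set S), IsSaOpen E A ∧ IsOpen B ∧
          (Q.1 : Set (X × S)) = A ×ˢ B := fun Q => by
        obtain ⟨A, B, ⟨hA, -⟩, ⟨hB, -⟩, h⟩ := Q.2
        exact ⟨A, B, hA, hB.1, h⟩
      choose A B hA hB hAB using key
      have hA' : ∀ Ψ : Set (Box E F X S), Ψ.Finite → IsSaOpen E (U ∩ ⋂ Q ∈ Ψ, A Q) := by
        intro Ψ hΨ
        induction Ψ, hΨ using Set.Finite.induction_on with
        | empty => simpa using hU
        | insert _ _ ih =>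
          rw [Set.biInter_insert, Set.inter_left_comm]
          exact (hA _).inter ih
      refine ⟨(fun x => U ∩ ⋂ Q ∈ {Q ∈ Φ | x ∈ A Q}, A Q) '' U,
        (fun s => V ∩ ⋂ Q ∈ {Q ∈ Φ | s ∈ B Q}, B Q) '' V, ⟨?_, ?_⟩, ⟨?_, ?_⟩, ?_⟩
      · rintro _ ⟨x, -, rfl⟩
        exact ⟨hA' _ (hΦ.subset (Set.sep_subset _ _)), Set.inter_subset_left⟩
      · intro K _
        refine ⟨_, subset_rfl, ?_, ?_⟩
        · refine (hΦ.finite_subsets.image fun Ψ => U ∩ ⋂ Q ∈ Ψ, A Q).subset ?_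
          rintro _ ⟨x, -, rfl⟩
          exact ⟨_, Set.sep_subset _ _, rfl⟩
        · congr 1
          apply subset_antisymm
          · refine Set.sUnion_subset ?_
            rintro _ ⟨x, -, rfl⟩
            exact Set.inter_subset_left
          · intro x hx
            exact ⟨_, ⟨x, hx, rfl⟩, hx, Set.mem_iInter₂.2 fun Q hQ => hQ.2⟩
      · rintro _ ⟨s, -, rfl⟩
        exact hV.inter ((hΦ.subset (Set.sep_subset _ _)).isOpen_biInter fun Q _ => hB Q)
      · apply subset_antisymm
        · refine Set.sUnion_subset ?_
          rintro _ ⟨x, -, rfl⟩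
          exact Set.inter_subset_left
        · intro x hx
          exact ⟨_, ⟨x, hx, rfl⟩, hx, Set.mem_iInter₂.2 fun Q hQ => hQ.2⟩
      · rintro _ ⟨x, hx, rfl⟩ _ ⟨s, hs, rfl⟩
        obtain ⟨Q, hQ, hxs⟩ := Set.mem_iUnion₂.1 (hR (hUV (Set.mk_mem_prod hx hs)))
        rw [hAB Q] at hxs
        obtain ⟨f, hf⟩ := hT Q hQ
        refine ⟨_, _, Sieve.image_mem_functorPushforward (boxToRel E F X S) T hf, ?_⟩
        change _ ⊆ (Q.1 : Set (X × S))
        rw [hAB Q]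
        exact Set.prod_mono
          (Set.inter_subset_right.trans (Set.biInter_subset_of_mem ⟨hQ, hxs.1⟩))
          (Set.inter_subset_right.trans (Set.biInter_subset_of_mem ⟨hQ, hxs.2⟩))
    have := Coverage.Saturate.of (K := relCoverage E X S) _ _ hgen
    rwa [Sieve.generate_sieve] at this

instance : (biSaToOpens E F X S).IsContinuous (biSaTopology E F X S)
    (Opens.grothendieckTopology (X × S)) := by
  refine Functor.isContinuous_of_coverPreserving (compatiblePreserving_of_inf _ _ ?_) ⟨?_⟩
  · exact fun R R' => ⟨⟨R.1 ⊓ R'.1, R.2.inter R'.2⟩, (inf_le_left : R.1 ⊓ R'.1 ≤ R.1),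
      (inf_le_right : R.1 ⊓ R'.1 ≤ R'.1), fun d h h' => (le_inf h h' : d ≤ R.1 ⊓ R'.1)⟩
  · rintro W T hT y hy
    obtain ⟨𝓑, h𝓑, -, hW⟩ := W.2
    have hy' : y ∈ (W.1 : Set (X × S)) := hy
    rw [hW] at hy'
    obtain ⟨R, hR, hyR⟩ := hy'
    have hRW : R ⊆ (W.1 : Set (X × S)) := hW ▸ Set.subset_sUnion_of_mem hR
    obtain ⟨Φ, -, hΦT, hΦ⟩ := hT ⟨⟨R, (h𝓑 R hR).isOpen⟩, h𝓑 R hR⟩ hRW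
    obtain ⟨W', hW', hyW'⟩ := Set.mem_iUnion₂.1 (hΦ hyR)
    obtain ⟨f, hf⟩ := hΦT W' hW'
    exact ⟨_, _, Sieve.image_mem_functorPushforward (biSaToOpens E F X S) T hf, hyW'⟩

instance : (relToOpens E X S).IsContinuous (relTopology E X S)
    (Opens.grothendieckTopology (X × S)) := by
  refine Functor.isContinuous_of_coverPreserving (compatiblePreserving_of_inf _ _ ?_) ⟨?_⟩
  · exact fun R R' => ⟨⟨R.1 ⊓ R'.1, R.2.inter R'.2⟩, (inf_le_left : R.1 ⊓ R'.1 ≤ R.1),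
      (inf_le_right : R.1 ⊓ R'.1 ≤ R'.1), fun d h h' => (le_inf h h' : d ≤ R.1 ⊓ R'.1)⟩
  · rintro W T hT y hy
    have key : ∀ y ∈ W.1, ∃ (W' : RelOpen E X S) (f : W' ⟶ W), T f ∧ y ∈ W'.1 := by
      clear hy y
      induction hT with
      | of W T hT =>
        rintro ⟨x, s⟩ hy
        obtain ⟨𝓟, -, h𝓟, hW⟩ := W.2
        have hy' : (x, s) ∈ (W.1 : Set (X × S)) := hy
        rw [hW] at hy'
        obtain ⟨P, hP, hyP⟩ := hy'
        have hPW : P ⊆ (W.1 : Set (X × S)) := hW ▸ Set.subset_sUnion_of_mem hP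
        obtain ⟨U, V, hU, hV, rfl⟩ := h𝓟 P hP
        obtain ⟨𝒰, 𝒱, h𝒰, h𝒱, h⟩ := hT U V hU hV hPW
        obtain ⟨𝒰₀, hsub, -, hK⟩ := h𝒰.2 {x} isCompact_singleton
        obtain ⟨-, U', hU', hxU'⟩ : x ∈ {x} ∩ ⋃₀ 𝒰₀ := hK ▸ ⟨rfl, hyP.1⟩
        obtain ⟨V', hV', hsV'⟩ : s ∈ ⋃₀ 𝒱 := h𝒱.2 ▸ hyP.2
        obtain ⟨W', f, hf, hle⟩ := h U' (hsub hU') V' hV'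
        exact ⟨W', f, Sieve.le_generate T _ _ hf, hle ⟨hxU', hsV'⟩⟩
      | top W => exact fun y hy => ⟨W, 𝟙 W, trivial, hy⟩
      | transitive W T T' _ _ ih ih' =>
        intro y hy
        obtain ⟨W', f, hf, hyW'⟩ := ih y hy
        obtain ⟨W'', g, hg, hyW''⟩ := ih' hf y hyW'
        exact ⟨W'', g ≫ f, hg, hyW''⟩
    obtain ⟨W', f, hf, hyW'⟩ := key y hy
    exact ⟨_, _, Sieve.image_mem_functorPushforward (relToOpens E X S) T hf, hyW'⟩

/-! ### The categories of sheaves of complex vector spaces and the functors between them -/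

/-- `Mod(ℂ_{X × S})`. -/
abbrev ModTop : Type 1 := Sheaf (Opens.grothendieckTopology (X × S)) (ModuleCat.{0} ℂ)

/-- `Mod(ℂ_{X_sa × S_sa})`. -/
abbrev ModBiSa : Type 1 := Sheaf (biSaTopology E F X S) (ModuleCat.{0} ℂ)

/-- `Mod(ℂ_{X_sa × S})`. -/
abbrev ModRel : Type 1 := Sheaf (relTopology E X S) (ModuleCat.{0} ℂ)

/-- The inverse image `ρ'⁻¹` of the morphism of sites `ρ' : X × S → X_sa × S_sa`. -/
def rhoPrimeInv : ModBiSa E F X S ⥤ ModTop X S :=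
  (biSaToOpens E F X S).sheafPullback (ModuleCat.{0} ℂ) (biSaTopology E F X S)
    (Opens.grothendieckTopology (X × S))

/-- The inverse image `ρ_S⁻¹` of the morphism of sites `ρ_S : X × S → X_sa × S`. -/
def rhoSInv : ModRel E X S ⥤ ModTop X S :=
  (relToOpens E X S).sheafPullback (ModuleCat.{0} ℂ) (relTopology E X S)
    (Opens.grothendieckTopology (X × S))

/-- The inverse image `a⁻¹` of the morphism of sites `a : X_sa × S → X_sa × S_sa`. This morphism
is given by the inclusion of the basis `𝒯` of `X_sa × S_sa` in `op(X_sa × S)` (an infinite locally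
finite union of elements of `𝒯` need not lie in `op(X_sa × S)`); accordingly `a⁻¹ G` is
the inverse image, along `𝒯 ⊆ op(X_sa × S)`, of the restriction of `G` to the basis `𝒯`. -/
def aInv : ModBiSa E F X S ⥤ ModRel E X S :=
  (boxToBiSa E F X S).sheafPushforwardContinuous (ModuleCat.{0} ℂ) (boxTopology E F X S)
      (biSaTopology E F X S) ⋙
    (boxToRel E F X S).sheafPullback (ModuleCat.{0} ℂ) (boxTopology E F X S) (relTopology E X S)

end Sites

/-! ### Inverse images and tensor products -/

section Tensor

variable {C D : Type} [SmallCategory C] [SmallCategory D]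

/-- The canonical morphism from the presheaf tensor product of two sheaves to their tensor product
as sheaves (which is the associated sheaf of the former). -/
def toSheafTensor (K : GrothendieckTopology D) (A B : Sheaf K (ModuleCat.{0} ℂ)) :
    A.obj ⊗ B.obj ⟶ (A ⊗ B).obj :=
  letI := (sheafificationAdjunction K (ModuleCat.{0} ℂ)).rightAdjointLaxMonoidal
  Functor.LaxMonoidal.μ (sheafToPresheaf K (ModuleCat.{0} ℂ)) A B

variable {J : GrothendieckTopology C}

/-- The morphism `A ⊗ B ⟶ H` of sheaves determined by a morphism of presheaves from the presheaf
tensor product of `A` and `B` to `H`. -/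
def sheafTensorLift {A B H : Sheaf J (ModuleCat.{0} ℂ)} (φ : A.obj ⊗ B.obj ⟶ H.obj) : A ⊗ B ⟶ H :=
  (inv ((sheafificationAdjunction J (ModuleCat.{0} ℂ)).counit.app A) ⊗ₘ
      inv ((sheafificationAdjunction J (ModuleCat.{0} ℂ)).counit.app B)) ≫
    Functor.LaxMonoidal.μ (presheafToSheaf J (ModuleCat.{0} ℂ)) A.obj B.obj ≫
    ((sheafificationAdjunction J (ModuleCat.{0} ℂ)).homEquiv (A.obj ⊗ B.obj) H).symm φ

theorem toSheafTensor_sheafTensorLift {A B H : Sheaf J (ModuleCat.{0} ℂ)}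
    (φ : A.obj ⊗ B.obj ⟶ H.obj) : toSheafTensor J A B ≫ (sheafTensorLift φ).hom = φ := by
  let adj := sheafificationAdjunction J (ModuleCat.{0} ℂ)
  change adj.homEquiv _ _ (Functor.OplaxMonoidal.δ (presheafToSheaf J (ModuleCat.{0} ℂ)) A.obj B.obj
    ≫ (adj.counit.app A ⊗ₘ adj.counit.app B)) ≫ (sheafToPresheaf J (ModuleCat.{0} ℂ)).map (sheafTensorLift φ) = φ
  rw [← adj.homEquiv_naturality_right, ← Equiv.eq_symm_apply]
  rw [sheafTensorLift, Category.assoc]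
  erw [tensorHom_comp_tensorHom_assoc]
  simp [adj]

/-- The canonical morphism `u⁻¹(A ⊗ B) ⟶ u⁻¹A ⊗ u⁻¹B` for the inverse image `u⁻¹` of a morphism
of sites given by the continuous functor `u`: it corresponds to the morphism
`A ⊗ B ⟶ u_*(u⁻¹A ⊗ u⁻¹B)` which sends a tensor `a ⊗ b` of sections over `W` to the tensor of the
images of `a` and `b` in `(u⁻¹A)(u W)` and `(u⁻¹B)(u W)`. -/
def pullbackTensor (u : C ⥤ D) (J : GrothendieckTopology C) (K : GrothendieckTopology D)
    [u.IsContinuous J K] (A B : Sheaf J (ModuleCat.{0} ℂ)) :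
    (u.sheafPullback (ModuleCat.{0} ℂ) J K).obj (A ⊗ B) ⟶
      (u.sheafPullback (ModuleCat.{0} ℂ) J K).obj A ⊗
        (u.sheafPullback (ModuleCat.{0} ℂ) J K).obj B :=
  let adj := u.sheafAdjunctionContinuous (ModuleCat.{0} ℂ) J K
  let R := (Functor.whiskeringLeft _ _ (ModuleCat.{0} ℂ)).obj u.op
  (adj.homEquiv _ _).symm (sheafTensorLift
    (((adj.unit.app A).hom ⊗ₘ (adj.unit.app B).hom) ≫
      Functor.LaxMonoidal.μ R _ _ ≫ R.map (toSheafTensor K _ _)))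

end Tensor

end RelSubanalytic

end

open RelSubanalytic

/-!
Call the opens `u c` indexed by a site `C` a closure basis of a space `Z` if those with closure in
a given open `W` cover `W`, and if every open covering of the closure of `u c` is refined by a
covering of `c`. A sheaf on `Z` is then recovered from its restriction `G` to `C` by means of the
inner sections `lim G(c)`, where `c` runs over the objects with `closure (u c) ⊆ W`. It follows
that the functor of inner sections is left adjoint to the fully faithful direct image, so that it
is the inverse image along `u`. Being a right Kan extension along `c ↦ closure (u c)` followed by
restriction to the opens, it has a left adjoint itself: the sheaf associated with
`c ↦ colim F(W)`, where `W` runs over the open neighbourhoods of `closure (u c)`. These colimits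
are filtered, hence exact and compatible with tensor products.

Relatively compact subanalytic boxes form a closure basis of `X × S`, because their closures are
compact and each point has arbitrarily small ones. They are dense in `X_sa × S` and in
`X_sa × S_sa`, so the open sets of either site form a closure basis as well. Restriction to the
boxes is an equivalence on `X_sa × S_sa` and fully faithful on `X_sa × S`, so `a⁻¹ ∘ ρ'_!` is left
adjoint to `ρ_S⁻¹` and agrees with the exact functor constructed directly on `X_sa × S`.
-/

noncomputable section

open Opposite Limits

namespace RelSubanalytic

universe v' u'

section OpensAndSubsets

/-- The inclusion of the open subsets of `Z` in all its subsets. -/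
def opensToSet (Z : Type) [TopologicalSpace Z] : Opens Z ⥤ Set Z :=
  Monotone.functor (f := fun W => (W : Set Z)) fun _ _ h => h

variable {Z : Type} [TopologicalSpace Z]

instance : (opensToSet Z).Full := ⟨fun f => ⟨homOfLE (leOfHom f), rfl⟩⟩

instance : (opensToSet Z).Faithful := ⟨fun _ => Subsingleton.elim _ _⟩

instance : RepresentablyFlat (opensToSet Z) where
  cofiltered K :=
    have : Nonempty (StructuredArrow K (opensToSet Z)) :=
      ⟨StructuredArrow.mk (Y := (⊤ : Opens Z)) (homOfLE (Set.subset_univ K))⟩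
    { cone_objs := fun P Q =>
        ⟨StructuredArrow.mk (Y := P.right ⊓ Q.right)
          (homOfLE (Set.subset_inter (leOfHom P.hom) (leOfHom Q.hom))),
          StructuredArrow.homMk (homOfLE inf_le_left) (Subsingleton.elim _ _),
          StructuredArrow.homMk (homOfLE inf_le_right) (Subsingleton.elim _ _), trivial⟩
      cone_maps := fun P _ _ _ =>
        ⟨P, 𝟙 P, congrArg _ (StructuredArrow.hom_ext _ _ (Subsingleton.elim _ _))⟩ }

variable (Z) in
/-- The Grothendieck topology on the subsets of `Z` in which `K` is covered by the sieves that
contain the trace on `K` of a neighbourhood of each point of `K`. It extends the usual topology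
on the open subsets. -/
def subsetTopology : GrothendieckTopology (Set Z) where
  sieves K := {T | ∀ z ∈ K, ∃ W : Opens Z, z ∈ W ∧ T (homOfLE (inf_le_left : K ⊓ W ≤ K))}
  top_mem' K z _ := ⟨⊤, trivial, trivial⟩
  pullback_stable' K L T f hT z hz := by
    obtain ⟨W, hzW, hW⟩ := hT z (leOfHom f hz)
    exact ⟨W, hzW, T.downward_closed hW (homOfLE (Set.inter_subset_inter_left _ (leOfHom f)))⟩
  transitive' K T hT R hR z hz := by
    obtain ⟨W, hzW, hW⟩ := hT z hz
    obtain ⟨W', hzW', hW'⟩ := hR hW z ⟨hz, hzW⟩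
    refine ⟨W ⊓ W', ⟨hzW, hzW'⟩, R.downward_closed hW' (homOfLE ?_)⟩
    exact (inf_assoc K (W : Set Z) W').ge

instance : (opensToSet Z).IsContinuous (Opens.grothendieckTopology Z) (subsetTopology Z) := by
  refine Functor.isContinuous_of_coverPreserving (compatiblePreservingOfFlat _ _) ⟨?_⟩
  intro U T hT z hz
  obtain ⟨W, f, hf, hzW⟩ := hT z hz
  exact ⟨W, hzW, Sieve.downward_closed _ (Sieve.image_mem_functorPushforward (opensToSet Z) T hf)
    (homOfLE (Set.inter_subset_right : (U : Set Z) ∩ W ⊆ W))⟩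

end OpensAndSubsets

section ClosureFunctor

variable {Z C : Type} [TopologicalSpace Z] [Preorder C]

/-- The functor which sends `c` to the closure of `u c`. -/
def closureFunctor (u : C ⥤ Opens Z) : C ⥤ Set Z :=
  Monotone.functor (f := fun c => closure (u.obj c : Set Z)) fun _ _ h =>
    closure_mono (leOfHom (u.map (homOfLE h)))

/-- The inclusion of `u c` in its closure. -/
def toClosure (u : C ⥤ Opens Z) : u ⋙ opensToSet Z ⟶ closureFunctor u where
  app _ := homOfLE subset_closure

/-- The inclusion of the closure of `u c` in `W`. -/
def closureHom {u : C ⥤ Opens Z} {c : C} {W : Opens Z} (h : closure (u.obj c : Set Z) ⊆ W) :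
    (closureFunctor u).obj c ⟶ (opensToSet Z).obj W :=
  homOfLE h

/-- The inclusion of `u c` in an open neighbourhood `W` of its closure. -/
def homOfClosureLE {u : C ⥤ Opens Z} {c : C} {W : Opens Z}
    (h : closure (u.obj c : Set Z) ⊆ W) : u.obj c ⟶ W :=
  homOfLE (subset_closure.trans h)

/-- A family of open subsets `u c` of `Z`, indexed by the objects of a site, that is fine enough to
approximate all open subsets from inside: the `u c` whose closure lies in an open subset `W` cover
`W`, and every open covering of the closure of `u c` is refined by a covering of `c` in the site. -/
class IsClosureBasis (u : C ⥤ Opens Z) (J : GrothendieckTopology C) : Prop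
    extends (closureFunctor u).IsCocontinuous J (subsetTopology Z) where
  exists_mem {W : Opens Z} {z : Z} : z ∈ W → ∃ c, z ∈ u.obj c ∧ closure (u.obj c : Set Z) ⊆ W

end ClosureFunctor

section InnerSections

variable {Z C : Type} [TopologicalSpace Z] [Preorder C] (u : C ⥤ Opens Z)
  {A : Type u'} [Category.{v'} A] [HasLimitsOfSize.{0, 0} A]

/-- The presheaf `W ↦ lim G(c)`, where `c` runs over the objects such that the closure of `u c` is
contained in `W`. -/
abbrev innerSections : (Cᵒᵖ ⥤ A) ⥤ ((Opens Z)ᵒᵖ ⥤ A) :=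
  (closureFunctor u).op.ran ⋙ (Functor.whiskeringLeft _ _ _).obj (opensToSet Z).op

variable {u}

/-- The projection of the limit `lim G(c)` which defines the inner sections over `W`. -/
def innerπ (G : Cᵒᵖ ⥤ A) {c : C} {W : Opens Z} (h : closure (u.obj c : Set Z) ⊆ W) :
    ((innerSections u).obj G).obj (op W) ⟶ G.obj (op c) :=
  ((closureFunctor u).op.ran.obj G).map (closureHom h).op ≫
    ((closureFunctor u).op.ranCounit.app G).app (op c)

theorem map_innerπ (G : Cᵒᵖ ⥤ A) {c : C} {W W' : Opens Z} (h : closure (u.obj c : Set Z) ⊆ W)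
    (f : W ⟶ W') : ((innerSections u).obj G).map f.op ≫ innerπ G h =
      innerπ G (h.trans (leOfHom f)) := by
  dsimp [innerπ]
  rw [← Functor.map_comp_assoc, ← op_comp]
  rfl

theorem innerπ_map (G : Cᵒᵖ ⥤ A) {c d : C} {W : Opens Z} (h : closure (u.obj c : Set Z) ⊆ W)
    (f : d ⟶ c) :
    innerπ G h ≫ G.map f.op = innerπ G ((closure_mono (leOfHom (u.map f))).trans h) := by
  have hnat := ((closureFunctor u).op.ranCounit.app G).naturality f.op
  dsimp [innerπ] at hnat ⊢
  rw [Category.assoc, ← hnat, ← Functor.map_comp_assoc, ← op_comp]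
  rfl

theorem innerSections_map_innerπ {G G' : Cᵒᵖ ⥤ A} (φ : G ⟶ G') {c : C} {W : Opens Z}
    (h : closure (u.obj c : Set Z) ⊆ W) :
    ((innerSections u).map φ).app (op W) ≫ innerπ G' h = innerπ G h ≫ φ.app (op c) := by
  have hnat := NatTrans.congr_app ((closureFunctor u).op.ranCounit.naturality φ) (op c)
  dsimp [innerπ] at hnat ⊢
  rw [Category.assoc, ← hnat, NatTrans.naturality_assoc]

/-- The projections `innerπ` present the inner sections over `W` as a limit. -/
def innerπIsLimit (G : Cᵒᵖ ⥤ A) (W : Opens Z) :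
    IsLimit ((Functor.RightExtension.mk _ ((closureFunctor u).op.ranCounit.app G)).coneAt
      (op ((opensToSet Z).obj W))) :=
  (closureFunctor u).op.isPointwiseRightKanExtensionRanCounit G _

theorem innerSections_hom_ext {G : Cᵒᵖ ⥤ A} {W : Opens Z} {M : A}
    {f g : M ⟶ ((innerSections u).obj G).obj (op W)}
    (h : ∀ (c : C) (hc : closure (u.obj c : Set Z) ⊆ W), f ≫ innerπ G hc = g ≫ innerπ G hc) :
    f = g :=
  (innerπIsLimit G W).hom_ext fun P => h P.right.unop (leOfHom P.hom.unop)

/-- The morphism to the inner sections over `W` given by a compatible family of morphisms. -/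
def innerLift {G : Cᵒᵖ ⥤ A} {W : Opens Z} {M : A}
    (φ : ∀ c : C, closure (u.obj c : Set Z) ⊆ W → (M ⟶ G.obj (op c)))
    (hφ : ∀ (c d : C) (hc : closure (u.obj c : Set Z) ⊆ W) (f : d ⟶ c),
      φ c hc ≫ G.map f.op = φ d ((closure_mono (leOfHom (u.map f))).trans hc)) :
    M ⟶ ((innerSections u).obj G).obj (op W) :=
  (innerπIsLimit G W).lift
    { pt := M
      π :=
        { app := fun P => φ P.right.unop (leOfHom P.hom.unop)
          naturality := fun P _ f =>
            (Category.id_comp _).trans (hφ _ _ (leOfHom P.hom.unop) f.right.unop).symm } }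

theorem innerLift_innerπ {G : Cᵒᵖ ⥤ A} {W : Opens Z} {M : A}
    (φ : ∀ c : C, closure (u.obj c : Set Z) ⊆ W → (M ⟶ G.obj (op c)))
    (hφ : ∀ (c d : C) (hc : closure (u.obj c : Set Z) ⊆ W) (f : d ⟶ c),
      φ c hc ≫ G.map f.op = φ d ((closure_mono (leOfHom (u.map f))).trans hc))
    {c : C} (hc : closure (u.obj c : Set Z) ⊆ W) : innerLift φ hφ ≫ innerπ G hc = φ c hc :=
  (innerπIsLimit G W).fac _ (StructuredArrow.mk (closureHom hc).op)

end InnerSections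

section ClosureExt

variable {Z C : Type} [TopologicalSpace Z] [Preorder C] (u : C ⥤ Opens Z)
  {A : Type u'} [Category.{v'} A] [HasColimitsOfSize.{0, 0} A]

/-- The presheaf `c ↦ colim F(W)`, where `W` runs over the open neighbourhoods of the closure
of `u c`. -/
abbrev closureExt : ((Opens Z)ᵒᵖ ⥤ A) ⥤ (Cᵒᵖ ⥤ A) :=
  (opensToSet Z).op.lan ⋙ (Functor.whiskeringLeft _ _ _).obj (closureFunctor u).op

/-- The restriction of germs along the closure of `u c` to sections over `u c`. -/
def closureRes : closureExt u ⟶ (Functor.whiskeringLeft _ _ A).obj u.op :=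
  Functor.whiskerLeft (opensToSet Z).op.lan
      ((Functor.whiskeringLeft _ _ A).map (NatTrans.op (toClosure u))) ≫
    Functor.whiskerRight (inv (opensToSet Z).op.lanUnit) ((Functor.whiskeringLeft _ _ A).obj u.op)

theorem closureRes_app_app (F : (Opens Z)ᵒᵖ ⥤ A) (c : C) :
    ((closureRes u).app F).app (op c) =
      ((opensToSet Z).op.lan.obj F).map ((toClosure u).app c).op ≫
        (inv ((opensToSet Z).op.lanUnit.app F)).app (op (u.obj c)) := by
  simp [closureRes]

/-- Presheaf morphisms from the extension to closures amount to morphisms to inner sections. -/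
def closureExtAdjunction [HasLimitsOfSize.{0, 0} A] :
    closureExt (A := A) u ⊣ innerSections u :=
  ((opensToSet Z).op.lanAdjunction A).comp ((closureFunctor u).op.ranAdjunction A)

theorem closureExtAdjunction_homEquiv_innerπ [HasLimitsOfSize.{0, 0} A]
    {F : (Opens Z)ᵒᵖ ⥤ A} {G : Cᵒᵖ ⥤ A} (f : (closureExt u).obj F ⟶ G)
    {c : C} {W : Opens Z} (h : closure (u.obj c : Set Z) ⊆ W) :
    ((closureExtAdjunction u).homEquiv F G f).app (op W) ≫ innerπ G h =
      ((opensToSet Z).op.lanUnit.app F).app (op W) ≫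
        ((opensToSet Z).op.lan.obj F).map (closureHom h).op ≫ f.app (op c) := by
  let g := ((closureFunctor u).op.ranAdjunction A).homEquiv ((opensToSet Z).op.lan.obj F) G f
  have hg : g.app (op ((closureFunctor u).obj c)) ≫
      ((closureFunctor u).op.ranCounit.app G).app (op c) = f.app (op c) := by
    have := ((closureFunctor u).op.ranAdjunction A).homEquiv_counit (g := g)
    rw [Equiv.symm_apply_apply, Functor.ranAdjunction_counit] at this
    exact (NatTrans.congr_app this (op c)).symm
  have hadj : ((closureExtAdjunction u).homEquiv F G f).app (op W) =
      ((opensToSet Z).op.lanUnit.app F).app (op W) ≫ g.app (op ((opensToSet Z).obj W)) := by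
    rw [closureExtAdjunction, Adjunction.comp_homEquiv]
    rw [Equiv.trans_apply, Adjunction.homEquiv_unit, Functor.lanAdjunction_unit]
    rfl
  rw [hadj, innerπ, Category.assoc, ← hg]
  exact congrArg _ (g.naturality_assoc (closureHom h).op _).symm

theorem closureExtAdjunction_homEquiv_closureRes_innerπ [HasLimitsOfSize.{0, 0} A]
    (H : (Opens Z)ᵒᵖ ⥤ A) {c : C} {W : Opens Z} (h : closure (u.obj c : Set Z) ⊆ W) :
    ((closureExtAdjunction u).homEquiv H _ ((closureRes u).app H)).app (op W) ≫
      innerπ (u.op ⋙ H) h = H.map (homOfClosureLE h).op := by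
  let η := (opensToSet Z).op.lanUnit.app H
  have hf : ((toClosure u).app c ≫ closureHom h).op =
      ((opensToSet Z).map (homOfClosureLE h)).op := rfl
  calc _ = η.app (op W) ≫
        ((opensToSet Z).op.lan.obj H).map ((opensToSet Z).map (homOfClosureLE h)).op ≫
          (inv η).app (op (u.obj c)) := by
        refine (closureExtAdjunction_homEquiv_innerπ u ((closureRes u).app H) h).trans ?_
        rw [closureRes_app_app, ← Functor.map_comp_assoc, ← op_comp, hf]
    _ = H.map (homOfClosureLE h).op ≫ η.app (op (u.obj c)) ≫ (inv η).app (op (u.obj c)) :=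
        (η.naturality_assoc (homOfClosureLE h).op _).symm
    _ = H.map (homOfClosureLE h).op := by simp

end ClosureExt

section InnerUnits

variable {Z C : Type} [TopologicalSpace Z] [Preorder C] {u : C ⥤ Opens Z}
  {A : Type u'} [Category.{v'} A] [HasLimitsOfSize.{0, 0} A]

variable (u A) in
/-- The restriction of sections over `W` to inner sections. -/
def toInner : 𝟭 ((Opens Z)ᵒᵖ ⥤ A) ⟶ (Functor.whiskeringLeft _ _ A).obj u.op ⋙ innerSections u where
  app H :=
    { app := fun W => innerLift (G := u.op ⋙ H) (fun c hc => H.map (homOfClosureLE hc).op)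
        fun _ _ _ f => (H.map_comp _ (u.map f).op).symm
      naturality := fun W W' f => innerSections_hom_ext fun c hc => by
        have h := map_innerπ (u.op ⋙ H) hc f.unop
        dsimp at h ⊢
        rw [Category.assoc, Category.assoc, innerLift_innerπ, h, innerLift_innerπ]
        exact (H.map_comp _ _).symm }
  naturality H H' φ := by
    ext W : 2
    refine innerSections_hom_ext fun c hc => ?_
    have h := innerSections_map_innerπ (((Functor.whiskeringLeft _ _ A).obj u.op).map φ) hc
    dsimp at h ⊢
    rw [Category.assoc, Category.assoc, innerLift_innerπ, h, ← Category.assoc, innerLift_innerπ]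
    exact (φ.naturality _).symm

theorem toInner_innerπ (H : (Opens Z)ᵒᵖ ⥤ A) {c : C} {W : Opens Z}
    (h : closure (u.obj c : Set Z) ⊆ W) :
    ((toInner u A).app H).app (op W) ≫ innerπ (u.op ⋙ H) h = H.map (homOfClosureLE h).op :=
  innerLift_innerπ (G := u.op ⋙ H) (fun _ hc => H.map (homOfClosureLE hc).op)
    (fun _ _ _ f => (H.map_comp _ (u.map f).op).symm) h

variable [u.Full]

variable (u A) in
/-- The restriction of sections over `c` to inner sections over `u c`. -/
def restrictInner :
    𝟭 (Cᵒᵖ ⥤ A) ⟶ innerSections u ⋙ (Functor.whiskeringLeft _ _ A).obj u.op where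
  app G :=
    { app := fun c => innerLift (fun d hd => G.map (u.preimage (homOfClosureLE hd)).op)
        fun _ _ _ f => (G.map_comp _ f.op).symm
      naturality := fun c c' f => innerSections_hom_ext fun d hd => by
        have h := map_innerπ G hd (u.map f.unop)
        dsimp at h ⊢
        rw [Category.assoc, Category.assoc, innerLift_innerπ, h, innerLift_innerπ]
        exact (G.map_comp _ _).symm }
  naturality G G' φ := by
    ext c : 2
    refine innerSections_hom_ext fun d hd => ?_
    have h := innerSections_map_innerπ φ hd
    dsimp at h ⊢
    rw [Category.assoc, Category.assoc, innerLift_innerπ, h, ← Category.assoc, innerLift_innerπ]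
    exact (φ.naturality _).symm

theorem restrictInner_innerπ (G : Cᵒᵖ ⥤ A) {c d : C}
    (h : closure (u.obj d : Set Z) ⊆ u.obj c) (f : d ⟶ c) :
    ((restrictInner u A).app G).app (op c) ≫ innerπ G h = G.map f.op :=
  (innerLift_innerπ (fun _ hd => G.map (u.preimage (homOfClosureLE hd)).op)
    (fun _ _ _ f => (G.map_comp _ f.op).symm) h).trans
      (congrArg (fun g => G.map (Quiver.Hom.op g)) (Subsingleton.elim _ f))

theorem innerSections_map_restrictInner (G : Cᵒᵖ ⥤ A) :
    (innerSections u).map ((restrictInner u A).app G) =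
      (toInner u A).app ((innerSections u).obj G) := by
  ext W : 2
  refine innerSections_hom_ext fun c hc => innerSections_hom_ext fun d hd => ?_
  have h₁ := innerSections_map_innerπ ((restrictInner u A).app G) hc
  have h₂ := toInner_innerπ ((innerSections u).obj G) hc
  have h₃ := map_innerπ G hd (homOfClosureLE hc)
  dsimp at h₁ h₂ h₃ ⊢
  rw [h₁, h₂, h₃, Category.assoc]
  exact (congrArg _ (restrictInner_innerπ G hd (u.preimage (homOfClosureLE hd)))).trans
    (innerπ_map G hc _)

theorem restrictInner_whiskeringLeft (H : (Opens Z)ᵒᵖ ⥤ A) :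
    (restrictInner u A).app (u.op ⋙ H) =
      Functor.whiskerLeft u.op ((toInner u A).app H) := by
  ext c : 2
  refine innerSections_hom_ext fun d hd => ?_
  exact (restrictInner_innerπ (u.op ⋙ H) hd (u.preimage (homOfClosureLE hd))).trans
    (toInner_innerπ H hd).symm

end InnerUnits

section InnerSheaf

variable {Z C : Type} [TopologicalSpace Z] [Preorder C] (u : C ⥤ Opens Z)
  (J : GrothendieckTopology C)

variable {J} in
theorem IsClosureBasis.ofArrows_mem [h : IsClosureBasis u J] (W : Opens Z) :
    Sieve.ofArrows (fun c : {c // closure (u.obj c : Set Z) ⊆ W} => u.obj c)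
      (fun c => homOfClosureLE c.2) ∈ Opens.grothendieckTopology Z W := by
  intro z hz
  obtain ⟨c, hzc, hc⟩ := h.exists_mem hz
  exact ⟨_, _, Sieve.ofArrows_mk _ _ ⟨c, hc⟩, hzc⟩

variable {u} in
theorem IsClosureBasis.isIso_toInner [IsClosureBasis u J] [u.Full] {A : Type u'} [Category.{v'} A]
    [HasLimitsOfSize.{0, 0} A] (H : Sheaf (Opens.grothendieckTopology Z) A) :
    IsIso ((toInner u A).app H.obj) := by
  suffices ∀ W, IsIso (((toInner u A).app H.obj).app W) from NatIso.isIso_of_isIso_app _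
  rintro ⟨W⟩
  have hW := ofArrows_mem (J := J) u W
  refine isIso_of_yoneda_map_bijective _ fun M => ⟨fun f g hfg => ?_, fun f => ?_⟩
  · refine H.property.hom_ext_ofArrows _ hW fun c => ?_
    have h := toInner_innerπ H.obj c.2
    dsimp at h hfg ⊢
    rw [← h, ← Category.assoc, hfg, Category.assoc]
  · have hres {U : Opens Z} (c : {c // closure (u.obj c : Set Z) ⊆ W})
        (p : U ⟶ u.obj c.1) (e : {e // closure (u.obj e : Set Z) ⊆ U}) :
        ((f ≫ innerπ (u.op ⋙ H.obj) c.2) ≫ H.obj.map p.op) ≫ H.obj.map (homOfClosureLE e.2).op =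
          f ≫ innerπ (u.op ⋙ H.obj) (e.2.trans (leOfHom (p ≫ homOfClosureLE c.2))) := by
      rw [Category.assoc, Category.assoc, ← Functor.map_comp]
      exact congrArg _ (innerπ_map (u.op ⋙ H.obj) c.2 (u.preimage (homOfClosureLE e.2 ≫ p)))
    obtain ⟨s, hs, -⟩ := H.property.existsUnique_amalgamation_ofArrows _ hW
      (fun c => f ≫ innerπ (u.op ⋙ H.obj) c.2) fun U c d p q _ =>
        H.property.hom_ext_ofArrows _ (ofArrows_mem (J := J) u U) fun e =>
          (hres c p e).trans (hres d q e).symm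
    refine ⟨s, innerSections_hom_ext fun c hc => ?_⟩
    rw [Category.assoc]
    exact (congrArg _ (toInner_innerπ H.obj hc)).trans (hs ⟨c, hc⟩)

variable (A : Type u') [Category.{v'} A] [HasLimitsOfSize.{0, 0} A]

/-- The sheaf of inner sections of a sheaf. -/
def innerSheaf [(closureFunctor u).IsCocontinuous J (subsetTopology Z)] :
    Sheaf J A ⥤ Sheaf (Opens.grothendieckTopology Z) A :=
  (closureFunctor u).sheafPushforwardCocontinuous A J (subsetTopology Z) ⋙
    (opensToSet Z).sheafPushforwardContinuous A _ (subsetTopology Z)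

variable [IsClosureBasis u J] [u.IsContinuous J (Opens.grothendieckTopology Z)] [u.Full]

/-- A sheaf on `Z` is the sheaf of inner sections of its restriction to a closure basis. -/
def innerSheafIso :
    𝟭 _ ≅ u.sheafPushforwardContinuous A J (Opens.grothendieckTopology Z) ⋙ innerSheaf u J A :=
  NatIso.ofComponents
    (fun H =>
      (fullyFaithfulSheafToPresheaf _ A).preimageIso
        (@asIso _ _ _ _ ((toInner u A).app H.obj) (IsClosureBasis.isIso_toInner (u := u) J H)))
    fun φ => Sheaf.hom_ext ((toInner u A).naturality φ.hom)

/-- Inner sections are left adjoint to the direct image along a closure basis. -/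
def innerAdjunction :
    innerSheaf u J A ⊣ u.sheafPushforwardContinuous A J (Opens.grothendieckTopology Z) :=
  Adjunction.mkOfUnitCounit
    { unit :=
        { app := fun G => ⟨(restrictInner u A).app G.obj⟩
          naturality := fun _ _ φ => Sheaf.hom_ext ((restrictInner u A).naturality φ.hom) }
      counit := (innerSheafIso u J A).inv
      left_triangle := by
        ext1; ext1 G
        have h : (innerSheaf u J A).map ⟨(restrictInner u A).app G.obj⟩ =
            (innerSheafIso u J A).hom.app ((innerSheaf u J A).obj G) :=
          Sheaf.hom_ext (innerSections_map_restrictInner G.obj)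
        dsimp
        rw [Category.id_comp, h, Iso.hom_inv_id_app]
        rfl
      right_triangle := by
        ext1; ext1 H
        have h : ⟨(restrictInner u A).app (u.op ⋙ H.obj)⟩ =
            (u.sheafPushforwardContinuous A J _).map ((innerSheafIso u J A).hom.app H) :=
          Sheaf.hom_ext (restrictInner_whiskeringLeft H.obj)
        dsimp
        rw [Category.id_comp]
        refine (congrArg (CategoryStruct.comp · _) h).trans ?_
        rw [← Functor.map_comp, Iso.hom_inv_id_app]
        exact CategoryTheory.Functor.map_id _ _ }

end InnerSheaf

section Shriek

variable {Z C : Type} [TopologicalSpace Z] [Preorder C] (u : C ⥤ Opens Z)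
  (J : GrothendieckTopology C) (A : Type u') [Category.{v'} A] [HasColimitsOfSize.{0, 0} A]
  [HasWeakSheafify J A]

/-- The sheaf associated with the extension of a sheaf to the closures of the `u c`. When the `u c`
form a closure basis, it is the left adjoint of the inverse image along `u`. -/
abbrev shriek : Sheaf (Opens.grothendieckTopology Z) A ⥤ Sheaf J A :=
  sheafToPresheaf _ A ⋙ closureExt u ⋙ presheafToSheaf J A

section Res

variable [u.IsContinuous J (Opens.grothendieckTopology Z)]

/-- The restriction of germs along the closure of `u c` to sections over `u c`, for sheaves. -/
def shriekRes :
    shriek u J A ⟶ u.sheafPushforwardContinuous A J (Opens.grothendieckTopology Z) where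
  app F := ((sheafificationAdjunction J A).homEquiv _ _).symm ((closureRes u).app F.obj)
  naturality F G φ := by
    refine ((sheafificationAdjunction J A).homEquiv_naturality_left_symm _ _).symm.trans <|
      (congrArg _ ((closureRes u).naturality φ.hom)).trans
        ((sheafificationAdjunction J A).homEquiv_naturality_right_symm
          (Y := (u.sheafPushforwardContinuous A J (Opens.grothendieckTopology Z)).obj F)
          ((closureRes u).app F.obj)
          ((u.sheafPushforwardContinuous A J (Opens.grothendieckTopology Z)).map φ))

theorem toSheafify_shriekRes (F : Sheaf (Opens.grothendieckTopology Z) A) :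
    toSheafify J ((closureExt u).obj F.obj) ≫ ((shriekRes u J A).app F).hom =
      (closureRes u).app F.obj :=
  toSheafify_sheafifyLift _ _ _

end Res

variable [HasLimitsOfSize.{0, 0} A]

/-- The extension to closures is left adjoint to the inner sections, for sheaves. -/
def shriekInnerAdjunction [(closureFunctor u).IsCocontinuous J (subsetTopology Z)] :
    shriek u J A ⊣ innerSheaf u J A :=
  let adj := (closureExtAdjunction u).comp (sheafificationAdjunction J A)
  Adjunction.mkOfHomEquiv
    { homEquiv := fun F G =>
        (adj.homEquiv F.obj G).trans
          ((fullyFaithfulSheafToPresheaf _ A).homEquiv (Y := (innerSheaf u J A).obj G)).symm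
      homEquiv_naturality_left_symm := fun f g => adj.homEquiv_naturality_left_symm f.hom g.hom
      homEquiv_naturality_right := fun f g =>
        Sheaf.hom_ext (adj.homEquiv_naturality_right f g) }

theorem closureExtAdjunction_homEquiv_closureRes (H : (Opens Z)ᵒᵖ ⥤ A) :
    (closureExtAdjunction u).homEquiv H _ ((closureRes u).app H) = (toInner u A).app H := by
  ext W : 2
  refine innerSections_hom_ext fun c hc => ?_
  exact (closureExtAdjunction_homEquiv_closureRes_innerπ u H hc).trans (toInner_innerπ H hc).symm

variable [u.IsContinuous J (Opens.grothendieckTopology Z)] [u.Full] [IsClosureBasis u J]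

theorem shriekInnerAdjunction_homEquiv_shriekRes (H : Sheaf (Opens.grothendieckTopology Z) A) :
    (shriekInnerAdjunction u J A).homEquiv _ _ ((shriekRes u J A).app H) =
      (innerSheafIso u J A).hom.app H := by
  refine Sheaf.hom_ext ?_
  have h := congrArg ((closureExtAdjunction u).homEquiv H.obj _) (toSheafify_shriekRes u J A H)
  refine Eq.trans ?_ (h.trans (closureExtAdjunction_homEquiv_closureRes u A H.obj))
  simp only [shriekInnerAdjunction, Adjunction.mkOfHomEquiv_homEquiv]
  rw [Adjunction.comp_homEquiv]
  rfl

instance isRightAdjoint_sheafPushforwardContinuous_of_isClosureBasis :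
    (u.sheafPushforwardContinuous A J (Opens.grothendieckTopology Z)).IsRightAdjoint :=
  (innerAdjunction u J A).isRightAdjoint

/-- The inverse image along a closure basis is isomorphic to the inner sections. -/
def innerSheafIsoPullback :
    innerSheaf u J A ≅ u.sheafPullback A J (Opens.grothendieckTopology Z) :=
  (innerAdjunction u J A).leftAdjointUniq
    (u.sheafAdjunctionContinuous A J (Opens.grothendieckTopology Z))

/-- The inverse image along a closure basis is right adjoint to the extension to closures. -/
def shriekAdjunction : shriek u J A ⊣ u.sheafPullback A J (Opens.grothendieckTopology Z) :=
  (shriekInnerAdjunction u J A).ofNatIsoRight (innerSheafIsoPullback u J A)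

theorem shriekAdjunction_homEquiv_shriekRes_counit (H : Sheaf (Opens.grothendieckTopology Z) A) :
    (shriekAdjunction u J A).homEquiv _ _ ((shriekRes u J A).app H) ≫
      (u.sheafAdjunctionContinuous A J (Opens.grothendieckTopology Z)).counit.app H = 𝟙 H := by
  rw [shriekAdjunction, Adjunction.homEquiv_ofNatIsoRight_apply,
    shriekInnerAdjunction_homEquiv_shriekRes, Category.assoc, innerSheafIsoPullback,
    Adjunction.leftAdjointUniq_hom_app_counit]
  exact Iso.hom_inv_id_app _ _

end Shriek

section LanTensor

variable {C D : Type} [SmallCategory C] [SmallCategory D] (L : C ⥤ D)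
  {V : Type u'} [Category.{v'} V] [MonoidalCategory V] [HasColimitsOfSize.{0, 0} V]

/-- The canonical morphism `L_!(F ⊗ G) ⟶ L_! F ⊗ L_! G` for the left Kan extension along `L`. -/
def lanTensor (F G : C ⥤ V) : L.lan.obj (F ⊗ G) ⟶ L.lan.obj F ⊗ L.lan.obj G :=
  letI := (L.lanAdjunction V).leftAdjointOplaxMonoidal
  Functor.OplaxMonoidal.δ L.lan F G

theorem lanTensor_naturality {F F' G G' : C ⥤ V} (f : F ⟶ F') (g : G ⟶ G') :
    L.lan.map (f ⊗ₘ g) ≫ lanTensor L F' G' = lanTensor L F G ≫ (L.lan.map f ⊗ₘ L.lan.map g) :=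
  letI := (L.lanAdjunction V).leftAdjointOplaxMonoidal
  (Functor.OplaxMonoidal.δ_natural L.lan f g).symm

theorem lanUnit_lanTensor (F G : C ⥤ V) :
    L.lanUnit.app (F ⊗ G) ≫ Functor.whiskerLeft L (lanTensor L F G) =
      L.lanUnit.app F ⊗ₘ L.lanUnit.app G := by
  let := (L.lanAdjunction V).leftAdjointOplaxMonoidal
  have h := (L.lanAdjunction V).unit_app_tensor_comp_map_δ F G
  rw [L.lanAdjunction_unit] at h
  exact h.trans (Category.comp_id _)

instance isIso_lanTensor [∀ d, IsFiltered (CostructuredArrow L d)]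
    [∀ X : V, PreservesColimitsOfSize.{0, 0} (tensorLeft X)]
    [∀ X : V, PreservesColimitsOfSize.{0, 0} (tensorRight X)] (F G : C ⥤ V) :
    IsIso (lanTensor L F G) := by
  suffices ∀ d, IsIso ((lanTensor L F G).app d) from NatIso.isIso_of_isIso_app _
  intro d
  have := IsFiltered.isSifted (C := CostructuredArrow L d)
  let hF := L.isPointwiseLeftKanExtensionLeftKanExtensionUnit F d
  let hG := L.isPointwiseLeftKanExtensionLeftKanExtensionUnit G d
  let hFG := L.isPointwiseLeftKanExtensionLeftKanExtensionUnit (F ⊗ G) d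
  let c := ((Functor.LeftExtension.mk _ (L.leftKanExtensionUnit F)).coconeAt d).tensor
    ((Functor.LeftExtension.mk _ (L.leftKanExtensionUnit G)).coconeAt d)
  have hdesc : (lanTensor L F G).app d = hFG.desc c := hFG.uniq c _ fun P => by
    have hunit := NatTrans.congr_app (lanUnit_lanTensor L F G) P.left
    have hnat := (lanTensor L F G).naturality P.hom
    exact (Category.assoc _ _ _).trans <|
      (congrArg (CategoryStruct.comp ((L.lanUnit.app (F ⊗ G)).app P.left)) hnat).trans <|
      (Category.assoc _ _ _).symm.trans <|
      (congrArg (CategoryStruct.comp · _) hunit).trans <|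
      MonoidalCategory.tensorHom_comp_tensorHom _ _ _ _
  rw [hdesc]
  exact (IsColimit.nonempty_isColimit_iff_isIso_desc hFG).1 ⟨hF.tensor hG⟩

end LanTensor

section AdjointTriple

variable {𝒞 𝒟 : Type*} [Category 𝒞] [Category 𝒟] [MonoidalCategory 𝒞] [MonoidalCategory 𝒟]
  {T R : 𝒟 ⥤ 𝒞} {P : 𝒞 ⥤ 𝒟} (adj₁ : T ⊣ P) (adj₂ : P ⊣ R)

/-- The last factor of the composite is the mate of `ν`. By `hα` the unit of `adj₂` at `T.obj W` is
`α.app W ≫ R.map (adj₁.unit.app W)`, which reduces the claim to `he`. -/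
theorem unit_tensor_of_compatible [R.Full] [R.Faithful] {α : T ⟶ R}
    (hα : ∀ X, adj₁.homEquiv _ _ (α.app X) ≫ adj₂.counit.app X = 𝟙 X)
    (ν : ∀ X Y, R.obj X ⊗ R.obj Y ⟶ R.obj (X ⊗ Y))
    (hν : ∀ {X X' Y Y'} (f : X ⟶ X') (g : Y ⟶ Y'),
      (R.map f ⊗ₘ R.map g) ≫ ν X' Y' = ν X Y ≫ R.map (f ⊗ₘ g))
    {X Y : 𝒟} (e : T.obj (X ⊗ Y) ⟶ T.obj X ⊗ T.obj Y)
    (he : e ≫ (α.app X ⊗ₘ α.app Y) ≫ ν X Y = α.app (X ⊗ Y)) :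
    adj₁.unit.app (X ⊗ Y) ≫ P.map e ≫
        (adj₂.homEquiv _ _).symm ((adj₂.unit.app (T.obj X) ⊗ₘ adj₂.unit.app (T.obj Y)) ≫ ν _ _) =
      adj₁.unit.app X ⊗ₘ adj₁.unit.app Y := by
  have hunit (W : 𝒟) : adj₂.unit.app (T.obj W) = α.app W ≫ R.map (adj₁.unit.app W) := by
    have h : Function.Injective fun f : T.obj W ⟶ R.obj (P.obj (T.obj W)) =>
        adj₁.homEquiv _ _ f ≫ adj₂.counit.app _ := fun f g hfg =>
      (adj₁.homEquiv _ _).injective ((cancel_mono _).1 hfg)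
    refine h ?_
    have hcounit := adj₂.counit.naturality (adj₁.unit.app W)
    dsimp at hcounit ⊢
    rw [adj₁.homEquiv_naturality_right, Category.assoc, hcounit,
      ← Category.assoc, hα, Category.id_comp, adj₁.homEquiv_unit, Category.assoc,
      adj₂.left_triangle_components]
    exact Category.comp_id _
  have hν' := hν (adj₁.unit.app X) (adj₁.unit.app Y)
  dsimp at hν'
  rw [← adj₂.homEquiv_naturality_left_symm, hunit, hunit,
    ← MonoidalCategory.tensorHom_comp_tensorHom, Category.assoc, hν',
    ← Category.assoc (α.app X ⊗ₘ α.app Y), ← Category.assoc e, he,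
    adj₂.homEquiv_naturality_right_symm, adj₂.homEquiv_counit, ← Category.assoc, ← Category.assoc]
  exact (congrArg (CategoryStruct.comp · _) ((congrArg (CategoryStruct.comp · _)
    (adj₁.homEquiv_unit _ _ _).symm).trans (hα _))).trans (Category.id_comp _)

end AdjointTriple

section ClosureExtTensor

variable {Z C : Type} [TopologicalSpace Z] [Preorder C] (u : C ⥤ Opens Z)
  {V : Type u'} [Category.{v'} V] [MonoidalCategory V] [HasColimitsOfSize.{0, 0} V]

theorem isFiltered_costructuredArrow_op {C D : Type} [SmallCategory C] [SmallCategory D]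
    (F : C ⥤ D) [RepresentablyFlat F] (K : Dᵒᵖ) : IsFiltered (CostructuredArrow F.op K) :=
  IsFiltered.of_equivalence (structuredArrowOpEquivalence F (unop K))

/-- The canonical morphism from the extension to closures of a tensor product to the tensor product
of the extensions. -/
def closureExtTensor (F G : (Opens Z)ᵒᵖ ⥤ V) :
    (closureExt u).obj (F ⊗ G) ⟶ (closureExt u).obj F ⊗ (closureExt u).obj G :=
  Functor.whiskerLeft (closureFunctor u).op (lanTensor (opensToSet Z).op F G)

theorem closureExtTensor_naturality {F F' G G' : (Opens Z)ᵒᵖ ⥤ V} (f : F ⟶ F') (g : G ⟶ G') :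
    (closureExt u).map (f ⊗ₘ g) ≫ closureExtTensor u F' G' =
      closureExtTensor u F G ≫ ((closureExt u).map f ⊗ₘ (closureExt u).map g) :=
  congrArg (Functor.whiskerLeft (closureFunctor u).op) (lanTensor_naturality _ f g)

instance isIso_closureExtTensor [∀ X : V, PreservesColimitsOfSize.{0, 0} (tensorLeft X)]
    [∀ X : V, PreservesColimitsOfSize.{0, 0} (tensorRight X)] (F G : (Opens Z)ᵒᵖ ⥤ V) :
    IsIso (closureExtTensor u F G) :=
  have := isFiltered_costructuredArrow_op (opensToSet Z)
  inferInstanceAs (IsIso (((Functor.whiskeringLeft _ _ V).obj (closureFunctor u).op).map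
    (lanTensor (opensToSet Z).op F G)))

theorem closureExtTensor_closureRes (F G : (Opens Z)ᵒᵖ ⥤ V) :
    closureExtTensor u F G ≫ ((closureRes u).app F ⊗ₘ (closureRes u).app G) =
      (closureRes u).app (F ⊗ G) := by
  let L := (opensToSet Z).op
  have hinv : Functor.whiskerLeft L (lanTensor L F G) ≫
      (inv (L.lanUnit.app F) ⊗ₘ inv (L.lanUnit.app G)) = inv (L.lanUnit.app (F ⊗ G)) := by
    refine IsIso.eq_inv_of_hom_inv_id ?_
    refine (Category.assoc _ _ _).symm.trans <|
      (congrArg (CategoryStruct.comp · _) (lanUnit_lanTensor L F G)).trans ?_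
    refine (MonoidalCategory.tensorHom_comp_tensorHom _ _ _ _).trans ?_
    rw [IsIso.hom_inv_id, IsIso.hom_inv_id]
    exact MonoidalCategory.id_tensorHom_id _ _
  ext ⟨c⟩
  have hnat := (lanTensor L F G).naturality ((toClosure u).app c).op
  have hres := congrArg₂ MonoidalCategory.tensorHom
    (closureRes_app_app u F c) (closureRes_app_app u G c)
  rw [closureRes_app_app, ← NatTrans.congr_app hinv (op (u.obj c))]
  refine (congrArg (CategoryStruct.comp ((closureExtTensor u F G).app (op c))) (hres.trans
    (MonoidalCategory.tensorHom_comp_tensorHom _ _ _ _).symm)).trans ?_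
  refine (Category.assoc _ _ _).symm.trans <| Eq.trans ?_ (Category.assoc _ _ _)
  exact congrArg (CategoryStruct.comp · _) hnat.symm

end ClosureExtTensor

section SheafTensor

variable {C : Type} [SmallCategory C] {J : GrothendieckTopology C}

theorem toSheafTensor_naturality {A A' B B' : Sheaf J (ModuleCat.{0} ℂ)} (f : A ⟶ A')
    (g : B ⟶ B') :
    (f.hom ⊗ₘ g.hom) ≫ toSheafTensor J A' B' = toSheafTensor J A B ≫ (f ⊗ₘ g).hom :=
  letI := (sheafificationAdjunction J (ModuleCat.{0} ℂ)).rightAdjointLaxMonoidal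
  Functor.LaxMonoidal.μ_natural (sheafToPresheaf J (ModuleCat.{0} ℂ)) f g

theorem W_toSheafTensor (A B : Sheaf J (ModuleCat.{0} ℂ)) : J.W (toSheafTensor J A B) := by
  let adj := sheafificationAdjunction J (ModuleCat.{0} ℂ)
  have h : toSheafTensor J A B = adj.unit.app (A.obj ⊗ B.obj) ≫
      (sheafToPresheaf J (ModuleCat.{0} ℂ)).map
        (Functor.OplaxMonoidal.δ (presheafToSheaf J (ModuleCat.{0} ℂ)) A.obj B.obj ≫
          (adj.counit.app A ⊗ₘ adj.counit.app B)) := rfl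
  rw [h]
  refine MorphismProperty.comp_mem _ _ _ (J.W_adj_unit_app adj _) ?_
  rw [GrothendieckTopology.W_sheafToPresheaf_map_iff_isIso]
  infer_instance

theorem toSheafTensor_hom_ext {A B H : Sheaf J (ModuleCat.{0} ℂ)} {f g : A ⊗ B ⟶ H}
    (h : toSheafTensor J A B ≫ f.hom = toSheafTensor J A B ≫ g.hom) : f = g :=
  Sheaf.hom_ext ((W_toSheafTensor A B H.obj H.property).1 h)

theorem toSheafify_δ (F G : Cᵒᵖ ⥤ ModuleCat.{0} ℂ) :
    toSheafify J (F ⊗ G) ≫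
        (Functor.OplaxMonoidal.δ (presheafToSheaf J (ModuleCat.{0} ℂ)) F G).hom =
      (toSheafify J F ⊗ₘ toSheafify J G) ≫ toSheafTensor J _ _ :=
  let := (sheafificationAdjunction J (ModuleCat.{0} ℂ)).rightAdjointLaxMonoidal
  (sheafificationAdjunction J (ModuleCat.{0} ℂ)).unit_app_tensor_comp_map_δ F G

end SheafTensor

section PushforwardTensor

variable {C D : Type} [SmallCategory C] [SmallCategory D] (u : C ⥤ D) (J : GrothendieckTopology C)
  (K : GrothendieckTopology D) [u.IsContinuous J K]

/-- The canonical morphism `u_* A ⊗ u_* B ⟶ u_* (A ⊗ B)`. -/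
def pushforwardTensor (A B : Sheaf K (ModuleCat.{0} ℂ)) :
    (u.sheafPushforwardContinuous (ModuleCat.{0} ℂ) J K).obj A ⊗
        (u.sheafPushforwardContinuous (ModuleCat.{0} ℂ) J K).obj B ⟶
      (u.sheafPushforwardContinuous (ModuleCat.{0} ℂ) J K).obj (A ⊗ B) :=
  sheafTensorLift (Functor.whiskerLeft u.op (toSheafTensor K A B))

theorem toSheafTensor_pushforwardTensor (A B : Sheaf K (ModuleCat.{0} ℂ)) :
    toSheafTensor J _ _ ≫ (pushforwardTensor u J K A B).hom =
      Functor.whiskerLeft u.op (toSheafTensor K A B) :=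
  toSheafTensor_sheafTensorLift _

theorem toSheafTensor_tensorHom_pushforwardTensor {G G' : Sheaf J (ModuleCat.{0} ℂ)}
    {A B : Sheaf K (ModuleCat.{0} ℂ)}
    (f : G ⟶ (u.sheafPushforwardContinuous (ModuleCat.{0} ℂ) J K).obj A)
    (g : G' ⟶ (u.sheafPushforwardContinuous (ModuleCat.{0} ℂ) J K).obj B) :
    toSheafTensor J G G' ≫ ((f ⊗ₘ g) ≫ pushforwardTensor u J K A B).hom =
      (f.hom ⊗ₘ g.hom) ≫ Functor.whiskerLeft u.op (toSheafTensor K A B) := by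
  refine (Category.assoc _ _ _).symm.trans <|
    (congrArg (CategoryStruct.comp · _) (toSheafTensor_naturality f g)).symm.trans <|
    (Category.assoc _ _ _).trans ?_
  exact congrArg _ (toSheafTensor_pushforwardTensor u J K A B)

theorem pushforwardTensor_naturality {A A' B B' : Sheaf K (ModuleCat.{0} ℂ)} (f : A ⟶ A')
    (g : B ⟶ B') :
    ((u.sheafPushforwardContinuous (ModuleCat.{0} ℂ) J K).map f ⊗ₘ
        (u.sheafPushforwardContinuous (ModuleCat.{0} ℂ) J K).map g) ≫
        pushforwardTensor u J K A' B' =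
      pushforwardTensor u J K A B ≫
        (u.sheafPushforwardContinuous (ModuleCat.{0} ℂ) J K).map (f ⊗ₘ g) := by
  refine toSheafTensor_hom_ext ?_
  rw [toSheafTensor_tensorHom_pushforwardTensor]
  refine (congrArg (Functor.whiskerLeft u.op) (toSheafTensor_naturality f g)).trans ?_
  exact (congrArg (CategoryStruct.comp · (Functor.whiskerLeft u.op (f ⊗ₘ g).hom))
    (toSheafTensor_pushforwardTensor u J K A B)).symm.trans (Category.assoc _ _ _)

theorem pullbackTensor_eq (A B : Sheaf J (ModuleCat.{0} ℂ)) :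
    pullbackTensor u J K A B =
      ((u.sheafAdjunctionContinuous (ModuleCat.{0} ℂ) J K).homEquiv _ _).symm
        (((u.sheafAdjunctionContinuous (ModuleCat.{0} ℂ) J K).unit.app A ⊗ₘ
          (u.sheafAdjunctionContinuous (ModuleCat.{0} ℂ) J K).unit.app B) ≫
          pushforwardTensor u J K _ _) := by
  refine congrArg ((u.sheafAdjunctionContinuous (ModuleCat.{0} ℂ) J K).homEquiv _ _).symm
    (toSheafTensor_hom_ext ?_)
  refine (toSheafTensor_sheafTensorLift _).trans ?_
  refine Eq.trans ?_ (toSheafTensor_tensorHom_pushforwardTensor u J K _ _).symm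
  exact congrArg _ (Category.id_comp _)

end PushforwardTensor

section ShriekTensor

variable {Z C : Type} [TopologicalSpace Z] [Preorder C] (u : C ⥤ Opens Z)
  (J : GrothendieckTopology C)

theorem W_closureExt_map [(closureFunctor u).IsCocontinuous J (subsetTopology Z)]
    {A : Type u'} [Category.{v'} A] [HasColimitsOfSize.{0, 0} A] [HasLimitsOfSize.{0, 0} A]
    {F F' : (Opens Z)ᵒᵖ ⥤ A} {f : F ⟶ F'} (hf : (Opens.grothendieckTopology Z).W f) :
    J.W ((closureExt u).map f) := by
  intro G hG
  have hconj : (fun g : (closureExt u).obj F' ⟶ G => (closureExt u).map f ≫ g) =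
      ((closureExtAdjunction u).homEquiv F G).symm ∘ (fun g => f ≫ g) ∘
        ((closureExtAdjunction u).homEquiv F' G) := by
    funext g
    dsimp only [Function.comp_apply]
    rw [← Adjunction.homEquiv_naturality_left, Equiv.symm_apply_apply]
  have hbij := hf _ ((innerSheaf u J A).obj ⟨G, hG⟩).property
  exact hconj ▸ (Equiv.bijective _).comp (hbij.comp (Equiv.bijective _))

/-- The morphism induced by `toSheafTensor`, whose source is the sheaf associated with the extension
to closures of the presheaf tensor product. -/
abbrev shriekToSheafTensor (A B : Sheaf (Opens.grothendieckTopology Z) (ModuleCat.{0} ℂ)) :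
    (presheafToSheaf J _).obj ((closureExt u).obj (A.obj ⊗ B.obj)) ⟶ (shriek u J _).obj (A ⊗ B) :=
  (presheafToSheaf J _).map ((closureExt u).map (toSheafTensor _ A B))

instance isIso_shriekToSheafTensor [(closureFunctor u).IsCocontinuous J (subsetTopology Z)]
    (A B : Sheaf (Opens.grothendieckTopology Z) (ModuleCat.{0} ℂ)) :
    IsIso (shriekToSheafTensor u J A B) :=
  (J.W_iff _).1 (W_closureExt_map u J (W_toSheafTensor A B))

section Res

variable [u.IsContinuous J (Opens.grothendieckTopology Z)]

theorem toSheafify_δ_shriekRes (A B : Sheaf (Opens.grothendieckTopology Z) (ModuleCat.{0} ℂ)) :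
    toSheafify J ((closureExt u).obj A.obj ⊗ (closureExt u).obj B.obj) ≫
        (Functor.OplaxMonoidal.δ (presheafToSheaf J _) _ _ ≫
          ((shriekRes u J _).app A ⊗ₘ (shriekRes u J _).app B) ≫
            pushforwardTensor u J _ A B).hom =
      ((closureRes u).app A.obj ⊗ₘ (closureRes u).app B.obj) ≫
        Functor.whiskerLeft u.op (toSheafTensor _ A B) := by
  refine (Category.assoc _ _ _).symm.trans <|
    (congrArg (CategoryStruct.comp · _) (toSheafify_δ _ _)).trans <|
    (Category.assoc _ _ _).trans <|
    (congrArg _ (toSheafTensor_tensorHom_pushforwardTensor u J _ _ _)).trans <|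
    (Category.assoc _ _ _).symm.trans (congrArg (CategoryStruct.comp · _) ?_)
  refine (MonoidalCategory.tensorHom_comp_tensorHom _ _ _ _).trans ?_
  rw [toSheafify_shriekRes, toSheafify_shriekRes]
  rfl

theorem toSheafify_shriekToSheafTensor_shriekRes
    (A B : Sheaf (Opens.grothendieckTopology Z) (ModuleCat.{0} ℂ)) :
    toSheafify J ((closureExt u).obj (A.obj ⊗ B.obj)) ≫
        (shriekToSheafTensor u J A B ≫ (shriekRes u J _).app (A ⊗ B)).hom =
      (closureRes u).app (A.obj ⊗ B.obj) ≫ Functor.whiskerLeft u.op (toSheafTensor _ A B) := by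
  refine (Category.assoc _ _ _).symm.trans <|
    (congrArg (CategoryStruct.comp · _) (toSheafify_naturality J _).symm).trans <|
    (Category.assoc _ _ _).trans <|
    (congrArg _ (toSheafify_shriekRes u J _ (A ⊗ B))).trans ?_
  exact (closureRes u).naturality (toSheafTensor _ A B)

end Res

variable [(closureFunctor u).IsCocontinuous J (subsetTopology Z)]

/-- The isomorphism `shriek (A ⊗ B) ≅ shriek A ⊗ shriek B`. -/
def shriekTensorIso (A B : Sheaf (Opens.grothendieckTopology Z) (ModuleCat.{0} ℂ)) :
    (shriek u J _).obj (A ⊗ B) ≅ (shriek u J _).obj A ⊗ (shriek u J _).obj B :=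
  (asIso (shriekToSheafTensor u J A B)).symm ≪≫
    (presheafToSheaf J _).mapIso (asIso (closureExtTensor u A.obj B.obj)) ≪≫
    (Functor.Monoidal.μIso (presheafToSheaf J _) _ _).symm

theorem shriekToSheafTensor_shriekTensorIso_hom
    (A B : Sheaf (Opens.grothendieckTopology Z) (ModuleCat.{0} ℂ)) :
    shriekToSheafTensor u J A B ≫ (shriekTensorIso u J A B).hom =
      (presheafToSheaf J _).map (closureExtTensor u A.obj B.obj) ≫
        Functor.OplaxMonoidal.δ (presheafToSheaf J _) _ _ :=
  IsIso.hom_inv_id_assoc _ _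

theorem shriekTensorIso_naturality
    {A A' B B' : Sheaf (Opens.grothendieckTopology Z) (ModuleCat.{0} ℂ)} (f : A ⟶ A')
    (g : B ⟶ B') :
    (shriek u J _).map (f ⊗ₘ g) ≫ (shriekTensorIso u J A' B').hom =
      (shriekTensorIso u J A B).hom ≫ ((shriek u J _).map f ⊗ₘ (shriek u J _).map g) := by
  have hσ : shriekToSheafTensor u J A B ≫ (shriek u J _).map (f ⊗ₘ g) =
      (presheafToSheaf J _).map ((closureExt u).map (f.hom ⊗ₘ g.hom)) ≫
        shriekToSheafTensor u J A' B' :=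
    ((closureExt u ⋙ presheafToSheaf J _).map_comp _ _).symm.trans <|
      (congrArg (closureExt u ⋙ presheafToSheaf J _).map (toSheafTensor_naturality f g).symm).trans
        ((closureExt u ⋙ presheafToSheaf J _).map_comp _ _)
  have hδ : (presheafToSheaf J _).map ((closureExt u).map (f.hom ⊗ₘ g.hom)) ≫
      (presheafToSheaf J _).map (closureExtTensor u A'.obj B'.obj) =
      (presheafToSheaf J _).map (closureExtTensor u A.obj B.obj) ≫
        (presheafToSheaf J _).map ((closureExt u).map f.hom ⊗ₘ (closureExt u).map g.hom) :=
    ((presheafToSheaf J _).map_comp _ _).symm.trans <|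
      (congrArg (presheafToSheaf J _).map (closureExtTensor_naturality u f.hom g.hom)).trans
        ((presheafToSheaf J _).map_comp _ _)
  rw [← cancel_epi (shriekToSheafTensor u J A B), ← Category.assoc, hσ, Category.assoc,
    shriekToSheafTensor_shriekTensorIso_hom, ← Category.assoc, hδ, Category.assoc,
    ← Category.assoc (shriekToSheafTensor u J A B), shriekToSheafTensor_shriekTensorIso_hom,
    Category.assoc]
  exact congrArg _ (Functor.OplaxMonoidal.δ_natural _ _ _).symm

theorem shriekTensorIso_shriekRes [u.IsContinuous J (Opens.grothendieckTopology Z)]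
    (A B : Sheaf (Opens.grothendieckTopology Z) (ModuleCat.{0} ℂ)) :
    (shriekTensorIso u J A B).hom ≫
        ((shriekRes u J _).app A ⊗ₘ (shriekRes u J _).app B) ≫ pushforwardTensor u J _ A B =
      (shriekRes u J _).app (A ⊗ B) := by
  rw [← cancel_epi (shriekToSheafTensor u J A B), ← Category.assoc,
    shriekToSheafTensor_shriekTensorIso_hom, Category.assoc]
  refine Sheaf.hom_ext (sheafify_hom_ext J _ _
    ((u.sheafPushforwardContinuous _ J _).obj (A ⊗ B)).property ?_)
  refine Eq.trans ?_ (toSheafify_shriekToSheafTensor_shriekRes u J A B).symm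
  refine (Category.assoc _ _ _).symm.trans <|
    (congrArg (CategoryStruct.comp · _)
      (toSheafify_naturality J (closureExtTensor u A.obj B.obj)).symm).trans <|
    (Category.assoc _ _ _).trans <|
    (congrArg _ (toSheafify_δ_shriekRes u J A B)).trans <|
    (Category.assoc _ _ _).symm.trans (congrArg (CategoryStruct.comp · _) ?_)
  exact closureExtTensor_closureRes u A.obj B.obj

end ShriekTensor

section ShriekExact

variable {Z C : Type} [TopologicalSpace Z] [Preorder C] (u : C ⥤ Opens Z)
  (J : GrothendieckTopology C) (A : Type u') [Category.{0} A] {FA : A → A → Type*} {CA : A → Type}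
  [∀ X Y, FunLike (FA X Y) (CA X) (CA Y)] [ConcreteCategory A FA] [HasLimits A] [HasColimits A]
  [ReflectsLimits (forget A)] [PreservesFilteredColimits (forget A)] [PreservesLimits (forget A)]

instance preservesFiniteLimits_closureExt : PreservesFiniteLimits (closureExt (A := A) u) :=
  have := lan_preservesFiniteLimits_of_flat A (opensToSet Z)
  comp_preservesFiniteLimits _ _

instance preservesFiniteLimits_shriek [HasSheafify J A] : PreservesFiniteLimits (shriek u J A) :=
  have := comp_preservesFiniteLimits (closureExt u) (presheafToSheaf J A)
  comp_preservesFiniteLimits _ _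

end ShriekExact

section AdjunctionTensor

variable {Z C : Type} [TopologicalSpace Z] [Preorder C] {u : C ⥤ Opens Z}
  {J : GrothendieckTopology C} [u.IsContinuous J (Opens.grothendieckTopology Z)] [u.Full]
  [IsClosureBasis u J]

section FullyFaithful

variable (u J) (A : Type u') [Category.{v'} A] [HasLimitsOfSize.{0, 0} A]

/-- The direct image along a closure basis is fully faithful. -/
def fullyFaithfulSheafPushforwardContinuous :
    (u.sheafPushforwardContinuous A J (Opens.grothendieckTopology Z)).FullyFaithful :=
  have : IsIso (innerAdjunction u J A).counit := inferInstanceAs (IsIso (innerSheafIso u J A).inv)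
  (innerAdjunction u J A).fullyFaithfulROfIsIsoCounit

end FullyFaithful

variable {T : Sheaf (Opens.grothendieckTopology Z) (ModuleCat.{0} ℂ) ⥤ Sheaf J (ModuleCat.{0} ℂ)}
  (adj : T ⊣ u.sheafPullback (ModuleCat.{0} ℂ) J (Opens.grothendieckTopology Z))

/-- A left adjoint of the inverse image along a closure basis commutes with tensor products. -/
def leftAdjointTensorIso :
    tensor (Sheaf (Opens.grothendieckTopology Z) (ModuleCat.{0} ℂ)) ⋙ T ≅
      T.prod T ⋙ tensor (Sheaf J (ModuleCat.{0} ℂ)) :=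
  let θ := adj.leftAdjointUniq (shriekAdjunction u J (ModuleCat.{0} ℂ))
  Functor.isoWhiskerLeft _ θ ≪≫
    NatIso.ofComponents (G := (shriek u J (ModuleCat.{0} ℂ)).prod (shriek u J (ModuleCat.{0} ℂ)) ⋙
        tensor (Sheaf J (ModuleCat.{0} ℂ))) (fun P => shriekTensorIso u J P.1 P.2)
      (fun f => shriekTensorIso_naturality u J f.1 f.2) ≪≫
    Functor.isoWhiskerRight (NatIso.prod θ.symm θ.symm) _

theorem unit_leftAdjointTensorIso_pullbackTensor
    (A B : Sheaf (Opens.grothendieckTopology Z) (ModuleCat.{0} ℂ)) :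
    adj.unit.app (A ⊗ B) ≫
        (u.sheafPullback (ModuleCat.{0} ℂ) J (Opens.grothendieckTopology Z)).map
          ((leftAdjointTensorIso adj).hom.app (A, B)) ≫
        pullbackTensor u J (Opens.grothendieckTopology Z) (T.obj A) (T.obj B) =
      adj.unit.app A ⊗ₘ adj.unit.app B := by
  let θ := adj.leftAdjointUniq (shriekAdjunction u J (ModuleCat.{0} ℂ))
  have hff := fullyFaithfulSheafPushforwardContinuous u J (ModuleCat.{0} ℂ)
  have := hff.full
  have := hff.faithful
  rw [pullbackTensor_eq]
  refine unit_tensor_of_compatible adj _ (α := θ.hom ≫ shriekRes u J _) (fun H => ?_)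
    (pushforwardTensor u J _) (pushforwardTensor_naturality u J _) _ ?_
  · rw [NatTrans.comp_app, adj.homEquiv_naturality_right, adj.homEquiv_leftAdjointUniq_hom_app,
      ← Adjunction.homEquiv_unit, shriekAdjunction_homEquiv_shriekRes_counit]
  · have hθ (H : Sheaf (Opens.grothendieckTopology Z) (ModuleCat.{0} ℂ)) :
        θ.inv.app H ≫ (θ.hom ≫ shriekRes u J _).app H = (shriekRes u J _).app H := by simp
    have hα := (MonoidalCategory.tensorHom_comp_tensorHom (θ.inv.app A) (θ.inv.app B)
      ((θ.hom ≫ shriekRes u J _).app A) ((θ.hom ≫ shriekRes u J _).app B)).trans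
        (congrArg₂ MonoidalCategory.tensorHom (hθ A) (hθ B))
    change (θ.hom.app (A ⊗ B) ≫ (shriekTensorIso u J A B).hom ≫
      (θ.inv.app A ⊗ₘ θ.inv.app B)) ≫ _ = _
    rw [Category.assoc, Category.assoc, ← Category.assoc (θ.inv.app A ⊗ₘ _), hα,
      shriekTensorIso_shriekRes]
    rfl

end AdjunctionTensor

section ClosureBasisComp

variable {Z B C : Type} [TopologicalSpace Z] [Preorder B] [Preorder C]

/-- Continuous functors preserve covering sieves because the closed sieves form a sheaf. -/
theorem functorPushforward_mem_of_isContinuous (v : B ⥤ C) {J : GrothendieckTopology B}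
    (K : GrothendieckTopology C) [v.IsContinuous J K] {b : B} {T : Sieve b} (hT : T ∈ J b) :
    T.functorPushforward v ∈ K (v.obj b) := by
  have hs := v.op_comp_isSheaf_of_isSheaf_type (J := J) (classifier_isSheaf K)
  have h := (hs T hT).isSeparatedFor.ext
    (t₁ := ⟨K.close (T.functorPushforward v), K.close_isClosed _⟩)
    (t₂ := ⟨(⊤ : Sieve (v.obj b)), fun _ _ _ => trivial⟩) fun Q f hf => ?_
  · exact (K.close_eq_top_iff_mem _).1 (congrArg Subtype.val h)
  · refine Subtype.ext ?_
    change (K.close (T.functorPushforward v)).pullback (v.map f) = (⊤ : Sieve _).pullback (v.map f)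
    rw [Sieve.pullback_top, ← Sieve.mem_iff_pullback_eq_top]
    exact K.le_close _ _ (Sieve.image_mem_functorPushforward v T hf)

theorem IsClosureBasis.of_comp (v : B ⥤ C) (u : C ⥤ Opens Z) (J : GrothendieckTopology B)
    (K : GrothendieckTopology C) [v.IsContinuous J K] [v.IsCoverDense K]
    [IsClosureBasis (v ⋙ u) J] : IsClosureBasis u K where
  exists_mem hz := by
    obtain ⟨b, hb⟩ := IsClosureBasis.exists_mem (u := v ⋙ u) J hz
    exact ⟨v.obj b, hb⟩
  cover_lift {c S} hS := by
    refine K.transitive (v.is_cover_of_isCoverDense K c) _ ?_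
    rintro d _ ⟨⟨b, f, g, rfl⟩⟩
    rw [Sieve.pullback_comp]
    refine K.pullback_stable f (K.superset_covering ?_ (functorPushforward_mem_of_isContinuous v K
      ((closureFunctor (v ⋙ u)).cover_lift J (subsetTopology Z)
        ((subsetTopology Z).pullback_stable ((closureFunctor u).map g) hS))))
    rintro d _ ⟨b', i, j, hi, rfl⟩
    exact S.downward_closed hi ((closureFunctor u).map j)

end ClosureBasisComp

section AdjointSquare

variable {T M N P : Type*} [Category* T] [Category* M] [Category* N] [Category* P]
  {ρ : M ⥤ T} {ρ' : T ⥤ M} {σ : N ⥤ T} {σ' : T ⥤ N} {β : P ⥤ M} {β' : M ⥤ P} {γ : P ⥤ N}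
  {γ' : N ⥤ P}

/-- In a square of right adjoints `ρ' ⋙ β' ≅ σ' ⋙ γ'` in which `β'` is an equivalence and `γ'` is
fully faithful, a left adjoint of the left adjoint of `ρ'` yields a left adjoint of the left adjoint
of `σ'`. -/
def adjunctionOfRightAdjointSquare (adjρ : ρ ⊣ ρ') (adjσ : σ ⊣ σ') (adjβ : β ⊣ β') (adjγ : γ ⊣ γ')
    [β'.IsEquivalence] [γ'.Full] [γ'.Faithful] (e : ρ' ⋙ β' ≅ σ' ⋙ γ') {L : T ⥤ M} (adj : L ⊣ ρ) :
    L ⋙ β' ⋙ γ ⊣ σ :=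
  have := adjβ.isEquivalence_left_of_isEquivalence_right
  let adjβ' : β' ⊣ β :=
    β.asEquivalence.symm.toAdjunction.ofNatIsoLeft
      (β.asEquivalence.toAdjunction.rightAdjointUniq adjβ)
  let leftSquare : β ⋙ ρ ≅ γ ⋙ σ :=
    ((adjβ.comp adjρ).ofNatIsoRight e).leftAdjointUniq (adjγ.comp adjσ)
  (adj.comp (adjβ'.comp adjγ)).ofNatIsoRight <|
    Functor.associator γ' β ρ ≪≫ Functor.isoWhiskerLeft γ' leftSquare ≪≫
      (Functor.associator γ' γ σ).symm ≪≫ Functor.isoWhiskerRight (asIso adjγ.counit) σ ≪≫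
      σ.leftUnitor

end AdjointSquare

section Charts

variable {E : Type} [NormedAddCommGroup E] [NormedSpace ℝ E] [FiniteDimensional ℝ E] {X : Type}
  [TopologicalSpace X] (φ : OpenPartialHomeomorph X E)

theorem exists_euclidean_closedBall_subset {x : X} {N : Set X}
    (hN : IsOpen N) (hxN : x ∈ N) (hx : x ∈ φ.source) :
    ∃ r : ℝ, 0 < r ∧ Euclidean.closedBall (φ x) r ⊆ φ.target ∩ φ.symm ⁻¹' N :=
  Euclidean.nhds_basis_closedBall.mem_iff.1 <|
    Filter.inter_mem (φ.open_target.mem_nhds (φ.map_source hx))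
      ((φ.continuousAt_symm (φ.map_source hx)).preimage_mem_nhds
        (by rw [φ.left_inv hx]; exact hN.mem_nhds hxN))

theorem source_inter_preimage_ball_subset (v : E) (r : ℝ) :
    φ.source ∩ φ ⁻¹' Euclidean.ball v r ⊆ φ.symm '' Euclidean.closedBall v r :=
  fun y hy => ⟨φ y, Euclidean.ball_subset_closedBall hy.2, φ.left_inv hy.1⟩

theorem isCompact_symm_image_euclidean_closedBall {v : E} {r : ℝ}
    (h : Euclidean.closedBall v r ⊆ φ.target) :
    IsCompact (φ.symm '' Euclidean.closedBall v r) :=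
  Euclidean.isCompact_closedBall.image_of_continuousOn (φ.continuousOn_symm.mono h)

theorem mem_euclidean_ball_iff {v w : E} {r : ℝ} (hr : 0 < r) :
    v ∈ Euclidean.ball w r ↔ 0 < r ^ 2 - ‖toEuclidean v - toEuclidean w‖ ^ 2 := by
  rw [sub_pos, sq_lt_sq₀ (norm_nonneg _) hr.le, ← dist_eq_norm]
  exact Iff.rfl

end Charts

section SubanalyticNeighbourhoods

variable {E : Type} [NormedAddCommGroup E] [NormedSpace ℝ E] {X : Type} [TopologicalSpace X]
  [ChartedSpace E X]

theorem IsSemianalytic.isSubanalytic {A : Set X} (hA : IsSemianalytic 𝓘(ℝ, E) A)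
    (hc : IsCompact (closure A)) : IsSubanalytic 𝓘(ℝ, E) A := by
  intro x
  refine ⟨Set.univ, isOpen_univ, trivial, EuclideanSpace ℝ (Fin 0), inferInstance, inferInstance,
    inferInstance, Prod.fst ⁻¹' A, hA.preimage contMDiff_fst, ?_, ?_⟩
  · rw [← Set.prod_univ, closure_prod_eq]
    exact hc.prod isCompact_univ.closure
  · rw [Set.inter_univ, Set.image_preimage_eq _ Prod.fst_surjective]

variable [FiniteDimensional ℝ E]

theorem contMDiffOn_sub_norm_sq_chart [IsManifold 𝓘(ℝ, E) ω X] (x : X) (v : E) (r : ℝ) :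
    ContMDiffOn 𝓘(ℝ, E) 𝓘(ℝ, ℝ) ω
      (fun z => r - ‖toEuclidean (chartAt E x z) - toEuclidean v‖ ^ 2) (chartAt E x).source :=
  have h : ContDiff ℝ ω fun w : E => r - ‖toEuclidean w - toEuclidean v‖ ^ 2 :=
    contDiff_const.sub ((toEuclidean.contDiff.sub contDiff_const).norm_sq ℝ)
  h.contMDiff.comp_contMDiffOn contMDiffOn_chart

variable [T2Space X] [IsManifold 𝓘(ℝ, E) ω X]

theorem isSemianalytic_chart_preimage_ball (x : X) {v : E} {r : ℝ} (hr : 0 < r)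
    (h : Euclidean.closedBall v r ⊆ (chartAt E x).target) :
    IsSemianalytic 𝓘(ℝ, E) ((chartAt E x).source ∩ chartAt E x ⁻¹' Euclidean.ball v r) := by
  intro y
  by_cases hy : y ∈ (chartAt E x).source
  · refine ⟨(chartAt E x).source, (chartAt E x).open_source, hy, Unit, Unit, inferInstance,
      inferInstance, fun _ _ _ => 0,
      fun _ _ z => r ^ 2 - ‖toEuclidean (chartAt E x z) - toEuclidean v‖ ^ 2,
      fun _ _ => ⟨contMDiffOn_const, contMDiffOn_sub_norm_sq_chart x v _⟩, ?_⟩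
    ext z
    have hz := mem_euclidean_ball_iff (v := chartAt E x z) (w := v) hr
    exact ⟨fun hmem => ⟨hmem.2, (), fun _ => ⟨rfl, hz.1 hmem.1.2⟩⟩,
      fun ⟨hsource, _, hpos⟩ => ⟨⟨hsource, hz.2 (hpos ()).2⟩, hsource⟩⟩
  · refine ⟨_, (isCompact_symm_image_euclidean_closedBall _ h).isClosed.isOpen_compl, ?_, Empty,
      Empty, inferInstance, inferInstance, fun i => i.elim, fun i => i.elim, fun i => i.elim, ?_⟩
    · rintro ⟨w, hw, rfl⟩
      exact hy ((chartAt E x).map_target (h hw))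
    · ext z
      simp only [Set.mem_inter_iff, IsEmpty.exists_iff, and_false, Set.mem_ofPred_eq, iff_false]
      exact fun hz => hz.2 (source_inter_preimage_ball_subset _ _ _ hz.1)

variable (E) in
theorem exists_isSaOpen_closure_subset {x : X} {N : Set X} (hN : IsOpen N) (hx : x ∈ N) :
    ∃ U : Set X, IsSaOpen E U ∧ IsCompact (closure U) ∧ x ∈ U ∧ closure U ⊆ N := by
  have hxs : x ∈ (chartAt E x).source := mem_chart_source E x
  obtain ⟨r, hr, hsub⟩ := exists_euclidean_closedBall_subset (chartAt E x) hN hx hxs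
  have htarget : Euclidean.closedBall (chartAt E x x) r ⊆ (chartAt E x).target :=
    fun y hy => (hsub hy).1
  have hK := isCompact_symm_image_euclidean_closedBall (chartAt E x) htarget
  have hcl := closure_minimal (source_inter_preimage_ball_subset (chartAt E x) (chartAt E x x) r)
    hK.isClosed
  have hc := hK.of_isClosed_subset isClosed_closure hcl
  refine ⟨_, ⟨?_, (isSemianalytic_chart_preimage_ball x hr htarget).isSubanalytic hc⟩, hc,
    ⟨hxs, ?_⟩, hcl.trans ?_⟩
  · exact (chartAt E x).continuousOn.isOpen_inter_preimage (chartAt E x).open_source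
      Euclidean.isOpen_ball
  · exact Set.mem_preimage.2 (Euclidean.mem_ball_self hr)
  · rintro _ ⟨y, hy, rfl⟩
    exact (hsub hy).2

variable (E) in
theorem isSaCover_relativelyCompact {U : Set X} (hU : IsSaOpen E U) :
    IsSaCover E U {U' | (IsSaOpen E U' ∧ IsCompact (closure U')) ∧ U' ⊆ U} := by
  refine ⟨fun U' h => ⟨h.1.1, h.2⟩, fun K hK => ?_⟩
  choose B hB hBc hxB _ using fun x : X => exists_isSaOpen_closure_subset E isOpen_univ
    (Set.mem_univ x)
  obtain ⟨t, -, hcov⟩ := hK.elim_nhds_subcover B fun x _ => (hB x).1.mem_nhds (hxB x)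
  refine ⟨(fun x => U ∩ B x) '' t, ?_, t.finite_toSet.image _, ?_⟩
  · rintro _ ⟨x, -, rfl⟩
    exact ⟨⟨hU.inter (hB x), (hBc x).of_isClosed_subset isClosed_closure
      (closure_mono Set.inter_subset_right)⟩, Set.inter_subset_left⟩
  · simp_rw [Set.sUnion_image, Finset.mem_coe]
    rw [← Set.inter_iUnion₂, Set.inter_left_comm, Set.inter_eq_left.2 hcov, Set.inter_comm]

end SubanalyticNeighbourhoods

section BoxNeighbourhoods

variable (E F : Type) {X S : Type} [NormedAddCommGroup E] [NormedSpace ℝ E]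
  [FiniteDimensional ℝ E] [NormedAddCommGroup F] [NormedSpace ℝ F] [FiniteDimensional ℝ F]
  [TopologicalSpace X] [T2Space X] [ChartedSpace E X] [IsManifold 𝓘(ℝ, E) ω X]
  [TopologicalSpace S] [T2Space S] [ChartedSpace F S] [IsManifold 𝓘(ℝ, F) ω S]

theorem exists_box_closure_subset {z : X × S} {W : Opens (X × S)} (hz : z ∈ W) :
    ∃ R : Box E F X S, z ∈ R.1 ∧ closure (R.1 : Set (X × S)) ⊆ W := by
  obtain ⟨N, N', hN, hN', hzN, hzN', hsub⟩ := isOpen_prod_iff.1 W.isOpen z.1 z.2 hz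
  obtain ⟨U, hU, hUc, hzU, hUN⟩ := exists_isSaOpen_closure_subset E hN hzN
  obtain ⟨V, hV, hVc, hzV, hVN⟩ := exists_isSaOpen_closure_subset F hN' hzN'
  refine ⟨⟨⟨U ×ˢ V, hU.1.prod hV.1⟩, U, V, ⟨hU, hUc⟩, ⟨hV, hVc⟩, rfl⟩, ⟨hzU, hzV⟩, ?_⟩
  exact closure_prod_eq.trans_subset ((Set.prod_mono hUN hVN).trans hsub)

variable (X S)

instance isClosureBasis_boxToBiSa_comp :
    IsClosureBasis (boxToBiSa E F X S ⋙ biSaToOpens E F X S) (boxTopology E F X S) where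
  exists_mem hz := exists_box_closure_subset E F hz
  cover_lift {R T} hT := by
    choose! W hzW hW using hT
    have : Nonempty (Box E F X S) := ⟨R⟩
    choose! Q hzQ hQ using fun z hz => exists_box_closure_subset E F (hzW z hz)
    obtain ⟨t, ht, hcov⟩ := R.2.isCompact_closure.elim_nhds_subcover (fun z => (Q z).1)
      fun z hz => (Q z).1.isOpen.mem_nhds (hzQ z hz)
    refine ⟨(fun z => ⟨(Q z).1 ⊓ R.1, (Q z).2.inter R.2⟩) '' (t : Set (X × S)),
      t.finite_toSet.image _, ?_, ?_⟩
    · rintro _ ⟨z, hz, rfl⟩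
      refine ⟨homOfLE (inf_le_right : (Q z).1 ⊓ R.1 ≤ R.1), T.downward_closed (hW z (ht z hz))
        (homOfLE (Set.subset_inter (closure_mono Set.inter_subset_right) ?_))⟩
      exact (closure_mono Set.inter_subset_left).trans (hQ z (ht z hz))
    · intro y hy
      obtain ⟨z, hz, hyz⟩ := Set.mem_iUnion₂.1 (hcov (subset_closure hy))
      exact Set.mem_iUnion₂.2 ⟨_, ⟨z, hz, rfl⟩, hyz, hy⟩

end BoxNeighbourhoods

section Sites

variable (E F X S : Type) [NormedAddCommGroup E] [NormedSpace ℝ E] [NormedAddCommGroup F]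
  [NormedSpace ℝ F] [TopologicalSpace X] [ChartedSpace E X]
  [TopologicalSpace S] [ChartedSpace F S]

instance : (boxToBiSa E F X S).Full := ⟨fun f => ⟨homOfLE (leOfHom f), rfl⟩⟩

instance : (boxToRel E F X S).Full := ⟨fun f => ⟨homOfLE (leOfHom f), rfl⟩⟩

instance : (biSaToOpens E F X S).Full := ⟨fun f => ⟨homOfLE (leOfHom f), rfl⟩⟩

instance : (relToOpens E X S).Full := ⟨fun f => ⟨homOfLE (leOfHom f), rfl⟩⟩

variable [T2Space X] [T2Space S]

instance : (boxToBiSa E F X S).IsCoverDense (biSaTopology E F X S) :=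
  ⟨fun _ R hR => ⟨{(boxToBiSa E F X S).obj R}, Set.finite_singleton _, by
    rintro _ rfl
    exact ⟨homOfLE hR, Presieve.in_coverByImage _ _⟩, by
      rw [Set.biUnion_singleton]
      exact subset_rfl⟩⟩

instance : (boxToBiSa E F X S).IsDenseSubsite (boxTopology E F X S) (biSaTopology E F X S) where
  functorPushforward_mem_iff {R T} := by
    refine ⟨fun hT => ?_, functorPushforward_mem_of_isContinuous _ _⟩
    obtain ⟨Φ, hΦ, hΦT, hcov⟩ := hT R le_rfl
    have exists_box : ∀ W' : Φ, ∃ Q : Box E F X S, (∃ f : Q ⟶ R, T f) ∧ W'.1.1 ≤ Q.1 := by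
      rintro ⟨W', hW'⟩
      obtain ⟨_, Q, g, h, hg, -⟩ := hΦT W' hW'
      exact ⟨Q, ⟨g, hg⟩, leOfHom h⟩
    choose Q hQ hle using exists_box
    have := hΦ.to_subtype
    refine ⟨Set.range Q, Set.finite_range Q, Set.forall_mem_range.2 hQ, fun y hy => ?_⟩
    obtain ⟨W', hW', hyW'⟩ := Set.mem_iUnion₂.1 (hcov hy)
    exact Set.mem_iUnion₂.2 ⟨_, ⟨⟨W', hW'⟩, rfl⟩, hle ⟨W', hW'⟩ hyW'⟩

variable [FiniteDimensional ℝ E] [FiniteDimensional ℝ F] [IsManifold 𝓘(ℝ, E) ω X]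
  [IsManifold 𝓘(ℝ, F) ω S]

variable {E X} in
theorem isRelCover_coverByImage_boxToRel (W : RelOpen E X S) :
    IsRelCover X W (Sieve.coverByImage (boxToRel E F X S) W).arrows := by
  intro U V hU hV hUV
  refine ⟨_, {V' | (IsSaOpen F V' ∧ IsCompact (closure V')) ∧ V' ⊆ V},
    isSaCover_relativelyCompact E hU, ⟨fun V' h => h.1.1.1, ?_⟩, ?_⟩
  · refine subset_antisymm (Set.sUnion_subset fun V' h => h.2) fun s hs => ?_
    obtain ⟨V', hV', hc, hsV', hsub⟩ := exists_isSaOpen_closure_subset F hV hs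
    exact ⟨V', ⟨⟨hV', hc⟩, subset_closure.trans hsub⟩, hsV'⟩
  · rintro U' ⟨hU', hUU'⟩ V' ⟨hV', hVV'⟩
    let R : Box E F X S := ⟨⟨U' ×ˢ V', hU'.1.1.prod hV'.1.1⟩, U', V', hU', hV', rfl⟩
    exact ⟨(boxToRel E F X S).obj R, homOfLE ((Set.prod_mono hUU' hVV').trans hUV),
      Presieve.in_coverByImage _ _, subset_rfl⟩

instance : (boxToRel E F X S).IsCoverDense (relTopology E X S) where
  is_cover W := by
    have := Coverage.Saturate.of (K := relCoverage E X S) _ _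
      (isRelCover_coverByImage_boxToRel F S W)
    rwa [Sieve.generate_sieve] at this

instance isClosureBasis_biSaToOpens :
    IsClosureBasis (biSaToOpens E F X S) (biSaTopology E F X S) :=
  .of_comp (boxToBiSa E F X S) (biSaToOpens E F X S) (boxTopology E F X S) _

include F in
theorem isClosureBasis_relToOpens : IsClosureBasis (relToOpens E X S) (relTopology E X S) :=
  have : IsClosureBasis (boxToRel E F X S ⋙ relToOpens E X S) (boxTopology E F X S) :=
    isClosureBasis_boxToBiSa_comp E F X S
  .of_comp (boxToRel E F X S) (relToOpens E X S) (boxTopology E F X S) _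

/-- If `ρ'_!` is left adjoint to `ρ'⁻¹`, then `a⁻¹ ∘ ρ'_!` is left adjoint to `ρ_S⁻¹`. -/
def rhoSShriekAdjunction {L : ModTop X S ⥤ ModBiSa E F X S} (adj : L ⊣ rhoPrimeInv E F X S) :
    L ⋙ aInv E F X S ⊣ rhoSInv E X S :=
  have := isClosureBasis_relToOpens E F X S
  adjunctionOfRightAdjointSquare
    ((biSaToOpens E F X S).sheafAdjunctionContinuous (ModuleCat.{0} ℂ) (biSaTopology E F X S)
      (Opens.grothendieckTopology (X × S)))
    ((relToOpens E X S).sheafAdjunctionContinuous (ModuleCat.{0} ℂ) (relTopology E X S)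
      (Opens.grothendieckTopology (X × S)))
    ((boxToBiSa E F X S).sheafAdjunctionContinuous (ModuleCat.{0} ℂ) (boxTopology E F X S)
      (biSaTopology E F X S))
    ((boxToRel E F X S).sheafAdjunctionContinuous (ModuleCat.{0} ℂ) (boxTopology E F X S)
      (relTopology E X S))
    (Iso.refl _) adj

end Sites

end RelSubanalytic

end

theorem mainTheorem7_general
    (E F X S : Type)
    [NormedAddCommGroup E] [NormedSpace ℝ E] [FiniteDimensional ℝ E]
    [NormedAddCommGroup F] [NormedSpace ℝ F] [FiniteDimensional ℝ F]
    [TopologicalSpace X] [T2Space X] [ChartedSpace E X] [IsManifold 𝓘(ℝ, E) ω X]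
    [TopologicalSpace S] [T2Space S] [ChartedSpace F S] [IsManifold 𝓘(ℝ, F) ω S] :
    ∃ (rhoPrimeShriek : ModTop X S ⥤ ModBiSa E F X S)
      (_ : rhoPrimeShriek ⊣ rhoPrimeInv E F X S)
      (rhoSShriek : ModTop X S ⥤ ModRel E X S)
      (_ : rhoSShriek = rhoPrimeShriek ⋙ aInv E F X S)
      (adj : rhoSShriek ⊣ rhoSInv E X S),
      (Limits.PreservesFiniteLimits rhoSShriek ∧ Limits.PreservesFiniteColimits rhoSShriek) ∧
      ∃ e : tensor (ModTop X S) ⋙ rhoSShriek ≅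
          rhoSShriek.prod rhoSShriek ⋙ tensor (ModRel E X S),
        ∀ A B : ModTop X S,
          adj.unit.app (A ⊗ B) ≫ (rhoSInv E X S).map (e.hom.app (A, B)) ≫
              pullbackTensor (relToOpens E X S) (relTopology E X S)
                (Opens.grothendieckTopology (X × S)) (rhoSShriek.obj A) (rhoSShriek.obj B) =
            adj.unit.app A ⊗ₘ adj.unit.app B := by
  have := isClosureBasis_relToOpens E F X S
  let adjPrime := shriekAdjunction (biSaToOpens E F X S) (biSaTopology E F X S) (ModuleCat.{0} ℂ)
  let adjS := rhoSShriekAdjunction E F X S adjPrime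
  let shriekIso := (shriekAdjunction (relToOpens E X S) (relTopology E X S)
    (ModuleCat.{0} ℂ)).leftAdjointUniq adjS
  exact ⟨_, adjPrime, _, rfl, adjS,
    ⟨Limits.preservesFiniteLimits_of_natIso shriekIso,
      have := adjS.leftAdjoint_preservesColimits; inferInstance⟩,
    leftAdjointTensorIso adjS, unit_leftAdjointTensorIso_pullbackTensor adjS⟩

theorem mainTheorem7
    (E F X S : Type)
    [NormedAddCommGroup E] [NormedSpace ℝ E] [FiniteDimensional ℝ E]
    [NormedAddCommGroup F] [NormedSpace ℝ F] [FiniteDimensional ℝ F]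
    [TopologicalSpace X] [T2Space X] [SecondCountableTopology X]
    [ChartedSpace E X] [IsManifold 𝓘(ℝ, E) ω X]
    [TopologicalSpace S] [T2Space S] [SecondCountableTopology S]
    [ChartedSpace F S] [IsManifold 𝓘(ℝ, F) ω S] :
    ∃ (rhoPrimeShriek : ModTop X S ⥤ ModBiSa E F X S)
      (_ : rhoPrimeShriek ⊣ rhoPrimeInv E F X S)
      (rhoSShriek : ModTop X S ⥤ ModRel E X S)
      (_ : rhoSShriek = rhoPrimeShriek ⋙ aInv E F X S)
      (adj : rhoSShriek ⊣ rhoSInv E X S),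
      (Limits.PreservesFiniteLimits rhoSShriek ∧ Limits.PreservesFiniteColimits rhoSShriek) ∧
      ∃ e : tensor (ModTop X S) ⋙ rhoSShriek ≅
          rhoSShriek.prod rhoSShriek ⋙ tensor (ModRel E X S),
        ∀ A B : ModTop X S,
          adj.unit.app (A ⊗ B) ≫ (rhoSInv E X S).map (e.hom.app (A, B)) ≫
              pullbackTensor (relToOpens E X S) (relTopology E X S)
                (Opens.grothendieckTopology (X × S)) (rhoSShriek.obj A) (rhoSShriek.obj B) =
            adj.unit.app A ⊗ₘ adj.unit.app B :=
  mainTheorem7_general E F X S
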